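/- For $n\ge 0$, order the symmetric group $S_n$ by the Bruhat order ($\sigma\le\tau$ if and only if $|\{i\le k:\sigma(i)\ge l\}|\le|\{i\le k:\tau(i)\ge l\}|$ for all $k,l\in\{1,\dots,n\}$), and give every subset of $S_n$ the induced order. Call $\sigma\in S_n$ an involution if $\sigma^2=1$ (so the identity is included). For $0\le a\le n$ with $a\equiv n \pmod 2$, let $F_n^a$ be the set of involutions in $S_n$ with exactly $a$ fixed points; it is a conjugacy class. A finite poset is graded if all its maximal chains have the same length; its rank function $\rho$ is then the unique function with $\rho(x)=0$ for minimal $x$ and $\rho(y)=\rho(x)+1$ whenever $y$ covers $x$. Let $\mathrm{inv}(\sigma)$ be the number of pairs $i<j$ with $\sigma(i)>\sigma(j)$. Then a conjugacy class of involutions in $S_n$ is graded if and only if it is one of $F_n^0$ ($n$ even), $F_n^1$ ($n$ odd), $F_n^{n-2}$ ($n\ge 2$), and $F_n^n$. Furthermore, the rank function of $F_n^0$ ($n$ even) and of $F_n^1$ ($n$ odd) is $$\rho(\sigma)=\frac{\mathrm{inv}(\sigma)-\lfloor n/2\rfloor}{2},$$ and the rank function of $F_n^{n-2}$ ($n\ge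 2$) is $$\rho(\sigma)=\frac{\mathrm{inv}(\sigma)-1}{2}.$$ In particular, $F_n^1$ is graded for every odd $n$, as conjectured by Hultman. -/

import Mathlib

namespace BruhatInvolutions

/-- The number of indices `i ≤ k` with `σ i ≥ l`. -/
def rankCount {n : ℕ} (σ : Equiv.Perm (Fin n)) (k l : Fin n) : ℕ :=
  (Finset.univ.filter fun i : Fin n => i ≤ k ∧ l ≤ σ i).card

theorem eq_of_rankCount_eq {n : ℕ} {σ τ : Equiv.Perm (Fin n)}
    (h : ∀ k l, rankCount σ k l = rankCount τ k l) : σ = τ := by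
  have key : ∀ (k : ℕ) (hk : k < n), σ ⟨k, hk⟩ = τ ⟨k, hk⟩ := by
    intro k
    induction k using Nat.strong_induction_on with
    | _ k ih =>
      intro hk
      -- separating off the index `k`, the counts of the two permutations below `k` agree
      have split : ∀ (π : Equiv.Perm (Fin n)) (l : Fin n),
          rankCount π ⟨k, hk⟩ l =
            (Finset.univ.filter fun i : Fin n => i < ⟨k, hk⟩ ∧ l ≤ π i).card +
              if l ≤ π ⟨k, hk⟩ then 1 else 0 := by
        intro π l
        have hd : (Finset.univ.filter fun i : Fin n => i ≤ ⟨k, hk⟩ ∧ l ≤ π i) =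
            (Finset.univ.filter fun i : Fin n => i < ⟨k, hk⟩ ∧ l ≤ π i) ∪
              (Finset.univ.filter fun i : Fin n => i = ⟨k, hk⟩ ∧ l ≤ π i) := by
          ext i
          simp only [Finset.mem_filter, Finset.mem_univ, true_and, Finset.mem_union,
            le_iff_lt_or_eq (a := i)]
          tauto
        have hs : (Finset.univ.filter fun i : Fin n => i = ⟨k, hk⟩ ∧ l ≤ π i) =
            if l ≤ π ⟨k, hk⟩ then {⟨k, hk⟩} else ∅ := by
          split_ifs with hl
          · ext i
            simp only [Finset.mem_filter, Finset.mem_univ, true_and, Finset.mem_singleton]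
            constructor
            · exact fun hi => hi.1
            · rintro rfl
              exact ⟨rfl, hl⟩
          · ext i
            simp only [Finset.mem_filter, Finset.mem_univ, true_and, Finset.notMem_empty,
              iff_false]
            rintro ⟨rfl, hi⟩
            exact hl hi
        have hdis : Disjoint (Finset.univ.filter fun i : Fin n => i < ⟨k, hk⟩ ∧ l ≤ π i)
            (Finset.univ.filter fun i : Fin n => i = ⟨k, hk⟩ ∧ l ≤ π i) := by
          rw [Finset.disjoint_left]
          intro i hi hj
          simp only [Finset.mem_filter, Finset.mem_univ, true_and] at hi hj
          exact hi.1.ne hj.1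
        rw [rankCount, hd, Finset.card_union_of_disjoint hdis, hs]
        split_ifs <;> simp
      have hlow : ∀ l : Fin n,
          (Finset.univ.filter fun i : Fin n => i < ⟨k, hk⟩ ∧ l ≤ σ i) =
            (Finset.univ.filter fun i : Fin n => i < ⟨k, hk⟩ ∧ l ≤ τ i) := by
        intro l
        refine Finset.filter_congr fun i _ => ?_
        refine and_congr_right fun hi => ?_
        rw [ih i.1 hi i.2]
      have hiff : ∀ l : Fin n, l ≤ σ ⟨k, hk⟩ ↔ l ≤ τ ⟨k, hk⟩ := by
        intro l
        have := h ⟨k, hk⟩ l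
        rw [split, split, hlow] at this
        by_cases h1 : l ≤ σ ⟨k, hk⟩ <;> by_cases h2 : l ≤ τ ⟨k, hk⟩ <;>
          simp [h1, h2] at this ⊢
      exact le_antisymm ((hiff _).1 le_rfl) ((hiff _).2 le_rfl)
  exact Equiv.ext fun i => key i.1 i.2

/-- The Bruhat order on the symmetric group; subsets carry the induced order. -/
instance bruhatOrder (n : ℕ) : PartialOrder (Equiv.Perm (Fin n)) where
  le σ τ := ∀ k l, rankCount σ k l ≤ rankCount τ k l
  le_refl _ _ _ := le_rfl
  le_trans _ _ _ h₁ h₂ k l := (h₁ k l).trans (h₂ k l)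
  le_antisymm _ _ h₁ h₂ := eq_of_rankCount_eq fun k l => le_antisymm (h₁ k l) (h₂ k l)

/-- The number of inversions: pairs `i < j` with `σ i > σ j`. -/
def inv {n : ℕ} (σ : Equiv.Perm (Fin n)) : ℕ :=
  (Finset.univ.filter fun p : Fin n × Fin n => p.1 < p.2 ∧ σ p.2 < σ p.1).card

/-- The involutions of `S_n` (the identity included) with exactly `a` fixed points. -/
def F (n a : ℕ) : Set (Equiv.Perm (Fin n)) :=
  {σ | σ * σ = 1 ∧ (Finset.univ.filter fun i : Fin n => σ i = i).card = a}

/-- A poset is graded of rank `r` if every maximal chain has length `r`, that is, has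
exactly `r + 1` elements. -/
def IsGradedOfRank (P : Type*) [PartialOrder P] (r : ℕ) : Prop :=
  ∀ s : Set P, IsMaxChain (· ≤ ·) s → s.ncard = r + 1

/-- A poset is graded if all its maximal chains have the same (finite) length. -/
def IsGraded (P : Type*) [PartialOrder P] : Prop :=
  ∃ r : ℕ, IsGradedOfRank P r

/-- The rank function of a graded poset: it is `0` at the minimal elements and increases by `1`
along every covering relation. -/
structure IsRankFunction {P : Type*} [PartialOrder P] (ρ : P → ℕ) : Prop where
  eq_zero_of_isMin : ∀ x, IsMin x → ρ x = 0
  eq_succ_of_covBy : ∀ x y, x ⋖ y → ρ y = ρ x + 1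

end BruhatInvolutions

namespace BruhatInvolutions
open Equiv Finset

/-! Write `cnt σ k l` for the number of graph points of `σ` below and left of a cut; larger in
Bruhat order means smaller counts (`le_iff_cnt`). Conjugating an involution by a suitable
transposition (`IsRise`) raises `inv` by exactly 2. The heart is `exists_conjSwap_le`: if `σ < τ`
have at most one fixed point, some such conjugate of `σ` still lies below `τ`. Where the counts
differ, a maximal rectangle of difference yields a graph point to swap with (`exists_rise_above`,
`exists_rise_below`). Usually a difference of 1 is enough. In the nested case the counts drop by 2
on a square, and the missing unit comes from parity: `cnt σ k k` has the parity of the number of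
fixed points below `k`. If the parities of `σ` and `τ` disagree, their fixed points differ, and the
swap can be made at the fixed point of `σ`. Hence every cover raises `inv` by 2. Minimal elements
are products of disjoint adjacent transpositions, so `inv` is constant on them, and a greatest
element exists; gradedness and the rank formula follow. For transpositions the order is inclusion of
intervals, and an end moves one step at a time. For `2 ≤ a ≤ n - 4`, `F 6 2` contains two
consecutive covers whose ends are also joined by a chain of length 3. A block sum with a fixed
involution carries this to `F n a`, because anything between two such block sums has the same second
block (`exists_eq_blockSum`). -/

/-! ### Counting functions, Bruhat order and inversions. -/

/-- The number of indices `p < k` with `σ p < l`, for cut points `k` and `l`. -/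
def cnt {n : ℕ} (σ : Perm (Fin n)) (k l : ℕ) : ℕ :=
  (univ.filter fun p : Fin n => p.val < k ∧ (σ p).val < l).card

theorem cnt_eq_sum {n : ℕ} (σ : Perm (Fin n)) (k l : ℕ) :
    (cnt σ k l : ℤ) = ∑ p : Fin n, if p.val < k ∧ (σ p).val < l then 1 else 0 := by
  simp [cnt]

theorem card_val_lt {n : ℕ} {k : ℕ} (hk : k ≤ n) :
    (univ.filter fun p : Fin n => p.val < k).card = k := by
  rw [Fin.card_filter_val_lt]; omega

theorem rankCount_add_cnt {n : ℕ} (σ : Perm (Fin n)) (k l : Fin n) :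
    rankCount σ k l + cnt σ (k + 1) l = k + 1 := by
  conv_rhs => rw [← card_val_lt (n := n) (k := k + 1) (by omega)]
  rw [rankCount, cnt, ← card_union_of_disjoint]
  · congr 1
    ext p
    simp only [mem_union, mem_filter, mem_univ, true_and, Fin.le_def]
    omega
  · rw [disjoint_left]
    intro p
    simp only [mem_filter, mem_univ, true_and, Fin.le_def]
    omega

theorem cnt_clamp {n : ℕ} (σ : Perm (Fin n)) (k l : ℕ) :
    cnt σ k l = cnt σ (min k n) (min l n) := by
  unfold cnt
  congr 1
  ext p
  have := p.2
  have := (σ p).2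
  simp only [mem_filter, mem_univ, true_and]
  omega

theorem cnt_of_ge_right {n : ℕ} (σ : Perm (Fin n)) (k l : ℕ) (hl : n ≤ l) :
    cnt σ k l = min k n := by
  rw [cnt_clamp]
  refine Eq.trans ?_ (card_val_lt (min_le_right k n))
  unfold cnt
  congr 1
  ext p
  have := (σ p).2
  simp only [mem_filter, mem_univ, true_and]
  omega

theorem cnt_zero_left {n : ℕ} (σ : Perm (Fin n)) (l : ℕ) : cnt σ 0 l = 0 := by
  simp [cnt]

/-- Among the first `k + 1` indices, `rankCount` and `cnt` count complementary sets, which reverses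
the inequality. Cuts at 0 or beyond `n` give the same count for every permutation. -/
theorem le_iff_cnt {n : ℕ} {σ τ : Perm (Fin n)} :
    σ ≤ τ ↔ ∀ k l, cnt τ k l ≤ cnt σ k l := by
  constructor
  · intro h k l
    rw [cnt_clamp τ, cnt_clamp σ]
    rcases Nat.eq_zero_or_pos (min k n) with hk | hk
    · rw [hk, cnt_zero_left, cnt_zero_left]
    by_cases hl : l < n
    · have h1 := rankCount_add_cnt σ ⟨min k n - 1, by omega⟩ ⟨l, hl⟩
      have h2 := rankCount_add_cnt τ ⟨min k n - 1, by omega⟩ ⟨l, hl⟩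
      have h3 := h ⟨min k n - 1, by omega⟩ ⟨l, hl⟩
      simp only [show min k n - 1 + 1 = min k n by omega] at h1 h2
      rw [show min l n = l by omega]
      omega
    · rw [cnt_of_ge_right _ _ _ (by omega), cnt_of_ge_right _ _ _ (by omega)]
  · intro h k l
    have h1 := rankCount_add_cnt σ k l
    have h2 := rankCount_add_cnt τ k l
    have h3 := h (k + 1) l
    omega

theorem eq_of_cnt_eq {n : ℕ} {σ τ : Perm (Fin n)} (h : ∀ k l, cnt σ k l = cnt τ k l) :
    σ = τ :=
  le_antisymm (le_iff_cnt.2 fun k l => (h k l).ge) (le_iff_cnt.2 fun k l => (h k l).le)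

theorem cnt_inv {n : ℕ} (σ : Perm (Fin n)) (k l : ℕ) : cnt σ⁻¹ k l = cnt σ l k := by
  unfold cnt
  refine card_bij (fun p _ => σ⁻¹ p) ?_ (fun _ _ _ _ h => σ⁻¹.injective h) ?_
  · intro p
    simp
    tauto
  · intro p hp
    refine ⟨σ p, ?_, by simp⟩
    simp at hp ⊢
    tauto

theorem cnt_comm {n : ℕ} {σ : Perm (Fin n)} (hσ : σ * σ = 1) (k l : ℕ) :
    cnt σ k l = cnt σ l k := by
  rw [← cnt_inv, inv_eq_of_mul_eq_one_left hσ]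

theorem invol_apply {n : ℕ} {σ : Perm (Fin n)} (hσ : σ * σ = 1) (p : Fin n) : σ (σ p) = p := by
  rw [← Perm.mul_apply, hσ, Perm.one_apply]

/-- The number of points of the graph of `σ` in a rectangle. -/
theorem cnt_rect {n : ℕ} (σ : Perm (Fin n)) {k k' l l' : ℕ} (hk : k ≤ k') (hl : l ≤ l') :
    cnt σ k' l' + cnt σ k l = cnt σ k' l + cnt σ k l' +
      (univ.filter fun p : Fin n => (k ≤ p.val ∧ p.val < k') ∧ l ≤ (σ p).val ∧ (σ p).val < l').card
      := by
  zify
  simp only [cnt_eq_sum, card_filter, Nat.cast_sum, ← sum_add_distrib]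
  refine sum_congr rfl fun p _ => ?_
  push_cast
  split_ifs <;> omega

/-- Two graph points move to the other two corners of their rectangle; only cuts through that
rectangle notice. -/
theorem cnt_mul_swap {n : ℕ} (σ : Perm (Fin n)) {x y : Fin n} (hxy : x < y) (hσ : σ x < σ y)
    (k l : ℕ) : (cnt (σ * swap x y) k l : ℤ) = cnt σ k l -
      if (x.val < k ∧ k ≤ y.val) ∧ (σ x).val < l ∧ l ≤ (σ y).val then 1 else 0 := by
  have hy : y ∈ univ.erase x := by simp [hxy.ne']
  rw [cnt_eq_sum, cnt_eq_sum, ← add_sum_erase univ _ (mem_univ x), ← add_sum_erase _ _ hy,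
    ← add_sum_erase univ (fun p => if p.val < k ∧ (σ p).val < l then (1 : ℤ) else 0) (mem_univ x),
    ← add_sum_erase _ (fun p => if p.val < k ∧ (σ p).val < l then (1 : ℤ) else 0) hy]
  have hr : ∑ p ∈ (univ.erase x).erase y,
      (if p.val < k ∧ ((σ * swap x y) p).val < l then (1 : ℤ) else 0) =
      ∑ p ∈ (univ.erase x).erase y, if p.val < k ∧ (σ p).val < l then (1 : ℤ) else 0 := by
    refine sum_congr rfl fun p hp => ?_
    simp only [mem_erase, mem_univ, and_true] at hp
    rw [Perm.mul_apply, swap_apply_of_ne_of_ne hp.2 hp.1]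
  rw [hr]
  simp only [Perm.mul_apply, swap_apply_left, swap_apply_right]
  rw [Fin.lt_def] at hxy hσ
  split_ifs <;> omega

/-- Exactly `σ p` indices have a value below `σ p`; those not to the left of `p` form inversions
with it. -/
theorem inv_eq_sum {n : ℕ} (σ : Perm (Fin n)) :
    (inv σ : ℤ) = ∑ p : Fin n, ((σ p : ℕ) - cnt σ p (σ p) : ℤ) := by
  have h1 : inv σ = ∑ p : Fin n, (univ.filter fun q : Fin n => p < q ∧ σ q < σ p).card := by
    simp only [inv, card_filter, ← univ_product_univ, sum_product]
  rw [h1]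
  push_cast
  refine sum_congr rfl fun p _ => ?_
  have h2 : (univ.filter fun q : Fin n => p < q ∧ σ q < σ p).card + cnt σ p (σ p) =
      cnt σ n (σ p) := by
    rw [cnt, cnt, ← card_union_of_disjoint]
    · congr 1
      ext q
      simp only [mem_union, mem_filter, mem_univ, true_and, Fin.lt_def]
      have : q.val = p.val → (σ q).val = (σ p).val := fun h => by rw [Fin.ext h]
      have := q.2
      omega
    · rw [disjoint_left]
      intro q
      simp only [mem_filter, mem_univ, true_and, Fin.lt_def]
      omega
  rw [← cnt_inv σ (σ p) n, cnt_of_ge_right _ _ _ le_rfl, min_eq_left (σ p).2.le] at h2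
  omega

theorem inv_mul_swap {n : ℕ} (σ : Perm (Fin n)) {x y : Fin n} (hxy : x < y) (hσ : σ x < σ y)
    (he : ∀ p, x < p → p < y → ¬ (σ x < σ p ∧ σ p < σ y)) : inv (σ * swap x y) = inv σ + 1 := by
  have hy : y ∈ univ.erase x := by simp [hxy.ne']
  zify
  rw [inv_eq_sum, inv_eq_sum, ← add_sum_erase univ _ (mem_univ x), ← add_sum_erase _ _ hy,
    ← add_sum_erase univ (fun p => ((σ p : ℕ) - cnt σ p (σ p) : ℤ)) (mem_univ x),
    ← add_sum_erase _ (fun p => ((σ p : ℕ) - cnt σ p (σ p) : ℤ)) hy]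
  have hr : ∑ p ∈ (univ.erase x).erase y,
      (((σ * swap x y) p : ℕ) - cnt (σ * swap x y) p ((σ * swap x y) p) : ℤ) =
      ∑ p ∈ (univ.erase x).erase y, ((σ p : ℕ) - cnt σ p (σ p) : ℤ) := by
    refine sum_congr rfl fun p hp => ?_
    simp only [mem_erase, mem_univ, and_true] at hp
    rw [cnt_mul_swap σ hxy hσ, Perm.mul_apply, swap_apply_of_ne_of_ne hp.2 hp.1, if_neg, sub_zero]
    rintro ⟨⟨h1, h2⟩, h3, h4⟩
    refine he p h1 (lt_of_le_of_ne h2 hp.1) ⟨h3, lt_of_le_of_ne h4 fun h => hp.1 ?_⟩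
    exact σ.injective h
  rw [hr, cnt_mul_swap σ hxy hσ, cnt_mul_swap σ hxy hσ]
  simp only [Perm.mul_apply, swap_apply_left, swap_apply_right]
  have hd := cnt_rect σ hxy.le hσ.le
  have hs : (univ.filter fun p : Fin n => (x.val ≤ p.val ∧ p.val < y) ∧
      (σ x).val ≤ (σ p).val ∧ (σ p).val < (σ y).val) = {x} := by
    ext p
    simp only [mem_filter, mem_univ, true_and, mem_singleton]
    constructor
    · rintro ⟨⟨h1, h2⟩, h3, h4⟩
      by_contra hp
      exact he p (lt_of_le_of_ne h1 (Ne.symm hp)) h2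
        ⟨lt_of_le_of_ne h3 fun h => hp (σ.injective h).symm, h4⟩
    · rintro rfl
      exact ⟨⟨le_rfl, hxy⟩, le_rfl, hσ⟩
  rw [hs, card_singleton] at hd
  rw [if_neg (by simp), if_neg (by simp)]
  omega

theorem inv_inv_perm {n : ℕ} (σ : Perm (Fin n)) : inv σ⁻¹ = inv σ := by
  unfold inv
  refine card_bij (fun p _ => (σ⁻¹ p.2, σ⁻¹ p.1)) ?_ ?_ ?_
  · rintro ⟨p, q⟩
    simp
    tauto
  · rintro ⟨p, q⟩ _ ⟨p', q'⟩ _ h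
    simp at h ⊢
    tauto
  · rintro ⟨p, q⟩ h
    refine ⟨(σ q, σ p), ?_, by simp⟩
    simp at h ⊢
    tauto

/-! ### Conjugation by a transposition. -/

/-- The conjugate of `σ` by the transposition of `x` and `y`. -/
def conjSwap {n : ℕ} (σ : Perm (Fin n)) (x y : Fin n) : Perm (Fin n) :=
  swap x y * σ * swap x y

theorem conj_mem_F {n a : ℕ} {σ : Perm (Fin n)} (hσ : σ ∈ F n a) (π : Perm (Fin n)) :
    π * σ * π⁻¹ ∈ F n a := by
  obtain ⟨h1, h2⟩ := hσ
  refine ⟨?_, ?_⟩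
  · calc π * σ * π⁻¹ * (π * σ * π⁻¹) = π * (σ * σ) * π⁻¹ := by group
      _ = 1 := by rw [h1]; group
  · rw [← h2]
    refine card_bij (fun p _ => π⁻¹ p) ?_ (fun _ _ _ _ h => π⁻¹.injective h) ?_
    · intro p hp
      rw [mem_filter, Perm.mul_apply, Perm.mul_apply] at hp
      rw [mem_filter]
      exact ⟨mem_univ _, π.injective (by simpa using hp.2)⟩
    · intro p hp
      refine ⟨π p, ?_, by simp⟩
      rw [mem_filter] at hp ⊢
      simp [hp.2]

theorem conjSwap_mem_F {n a : ℕ} {σ : Perm (Fin n)} (hσ : σ ∈ F n a) (x y : Fin n) :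
    conjSwap σ x y ∈ F n a := by
  have := conj_mem_F hσ (swap x y)
  rwa [swap_inv] at this

/-- Conditions on an involution `σ` under which its conjugate by the transposition of `x` and `y`
has exactly two more inversions. -/
structure IsRise {n : ℕ} (σ : Perm (Fin n)) (x y : Fin n) : Prop where
  invol : σ * σ = 1
  lt : x < y
  map_lt : σ x < σ y
  map_le : σ x ≤ x
  fixed : σ x = x → y < σ y
  side : σ y < x ∨ y ≤ σ y
  empty : ∀ p, x < p → p < y → ¬ (σ x < σ p ∧ σ p < σ y)

namespace IsRise
variable {n : ℕ} {σ : Perm (Fin n)} {x y : Fin n}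

theorem map_ne (h : IsRise σ x y) : σ y ≠ x := by
  intro hy
  have hx : σ x = y := by rw [← hy, invol_apply h.invol]
  have := h.lt
  have := h.map_lt
  rw [hx, hy] at this
  exact lt_asymm this h.lt

theorem swap_map_right (h : IsRise σ x y) :
    swap x y (σ y) = if σ y = y then x else σ y := by
  split_ifs with hy
  · rw [hy, swap_apply_right]
  · exact swap_apply_of_ne_of_ne h.map_ne hy

theorem swap_map_left (h : IsRise σ x y) :
    swap x y (σ x) = if σ x = x then y else σ x := by
  split_ifs with hx
  · rw [hx, swap_apply_left]
  · exact swap_apply_of_ne_of_ne hx (h.map_le.trans_lt h.lt).ne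

theorem inv_mul_swap_inv (hσ : σ * σ = 1) : (σ * swap x y)⁻¹ = swap x y * σ := by
  rw [mul_inv_rev, swap_inv, inv_eq_of_mul_eq_one_left hσ]

theorem swap_map_lt (h : IsRise σ x y) : (swap x y * σ) x < (swap x y * σ) y := by
  have h1 := h.map_lt
  have h2 := h.map_le
  have h3 := h.fixed
  have h4 := h.lt
  rw [Perm.mul_apply, Perm.mul_apply, h.swap_map_left, h.swap_map_right]
  split_ifs with hx hy hy
  · exact absurd hy (h3 hx).ne'
  · exact h3 hx
  · exact lt_of_le_of_ne h2 hx
  · exact h1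

/-- The two one-sided multiplications each remove 1 on a rectangle. The second rectangle is the
mirror image of the first, except that it is truncated when `x` or `y` is fixed. -/
theorem cnt_conjSwap (h : IsRise σ x y) (k l : ℕ) :
    (cnt (conjSwap σ x y) k l : ℤ) = cnt σ k l
      - (if (x.val < l ∧ l ≤ y.val) ∧ (σ x).val < k ∧ k ≤ (σ y).val then 1 else 0)
      - (if (x.val < k ∧ k ≤ y.val) ∧ (if σ x = x then y else σ x).val < l ∧
          l ≤ (if σ y = y then x else σ y).val then 1 else 0) := by
  rw [conjSwap, cnt_mul_swap _ h.lt h.swap_map_lt, ← inv_mul_swap_inv h.invol, cnt_inv,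
    cnt_mul_swap _ h.lt h.map_lt, cnt_comm h.invol, inv_mul_swap_inv h.invol, Perm.mul_apply,
    Perm.mul_apply, h.swap_map_left, h.swap_map_right]

/-- Both multiplications swap across an empty rectangle. The condition `side` keeps the second one
empty: it rules out `σ y` strictly between `x` and `y`. -/
theorem inv_conjSwap (h : IsRise σ x y) : inv (conjSwap σ x y) = inv σ + 2 := by
  rw [conjSwap, inv_mul_swap _ h.lt h.swap_map_lt, ← inv_mul_swap_inv h.invol, inv_inv_perm,
    inv_mul_swap _ h.lt h.map_lt h.empty]
  intro p hxp hpy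
  have h1 := h.map_lt
  have h2 := h.map_le
  have h3 := h.fixed
  have h4 := h.lt
  have h5 := h.side
  have h6 := h.empty p hxp hpy
  have hx : σ p ≠ x := by
    intro hp
    have : σ x = p := by rw [← hp, invol_apply h.invol]
    rw [this] at h2
    exact absurd hxp h2.not_gt
  rw [Perm.mul_apply, Perm.mul_apply, Perm.mul_apply, h.swap_map_left, h.swap_map_right]
  by_cases hy : σ p = y
  · have hyp : σ y = p := by rw [← hy, invol_apply h.invol]
    rw [hyp] at h5
    omega
  · rw [swap_apply_of_ne_of_ne hx hy]
    split_ifs <;> omega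

/-- The conjugate lies below every `τ` above `σ` whose counts leave enough room. -/
theorem conjSwap_le (h : IsRise σ x y) {τ : Perm (Fin n)} (hτ : τ * τ = 1) (hle : σ ≤ τ)
    (h1 : ∀ k l, x.val < k → k ≤ y.val → (σ x).val < l → l ≤ (σ y).val → cnt τ k l < cnt σ k l)
    (h2 : y < σ y → σ x < x → ∀ k l, x.val < k → k ≤ y.val → x.val < l → l ≤ y.val →
      cnt τ k l + 2 ≤ cnt σ k l) : conjSwap σ x y ≤ τ := by
  rw [le_iff_cnt] at hle ⊢
  intro k l
  have a1 := h1 k l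
  have a2 := h1 l k
  have a3 := h2
  have a0 := hle k l
  have e := h.cnt_conjSwap k l
  rw [cnt_comm hτ l k, cnt_comm h.invol l k] at a2
  have b1 := h.map_lt
  have b2 := h.map_le
  have b3 := h.fixed
  have b4 := h.lt
  have b5 := h.side
  -- The two rectangles overlap only in this nested case, and then exactly in the square with both
  -- cuts between `x` and `y`.
  by_cases c1 : y < σ y ∧ σ x < x
  · have a4 := a3 c1.1 c1.2 k l
    rw [if_neg c1.2.ne, if_neg c1.1.ne'] at e
    split_ifs at e <;> omega
  · split_ifs at e <;> omega

theorem le_conjSwap (h : IsRise σ x y) : σ ≤ conjSwap σ x y := by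
  rw [le_iff_cnt]
  intro k l
  have e := h.cnt_conjSwap k l
  split_ifs at e <;> omega

theorem lt_conjSwap (h : IsRise σ x y) : σ < conjSwap σ x y := by
  refine lt_of_le_of_ne h.le_conjSwap fun he => ?_
  have := h.inv_conjSwap
  rw [← he] at this
  omega

end IsRise

/-! ### Boxes on which two comparable permutations differ. -/

/-- Two points of the graph of `σ` in increasing position, with no further points strictly inside
their rectangle, on which the counts of `σ` exceed those of `τ`. -/
structure IsBox {n : ℕ} (σ τ : Perm (Fin n)) (p j : Fin n) : Prop where
  lt : p < j
  map_lt : σ p < σ j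
  cnt_lt : ∀ k l, p.val < k → k ≤ j.val → (σ p).val < l → l ≤ (σ j).val → cnt τ k l < cnt σ k l
  empty : ∀ q, p < q → q < j → ¬ (σ p < σ q ∧ σ q < σ j)

theorem IsBox.symm {n : ℕ} {σ τ : Perm (Fin n)} (hσ : σ * σ = 1) (hτ : τ * τ = 1) {p j : Fin n}
    (h : IsBox σ τ p j) : IsBox σ τ (σ p) (σ j) := by
  refine ⟨h.map_lt, ?_, fun k l h1 h2 h3 h4 => ?_, fun q h1 h2 => ?_⟩
  · simpa only [invol_apply hσ] using h.lt
  · simp only [invol_apply hσ] at h3 h4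
    rw [cnt_comm hσ, cnt_comm hτ]
    exact h.cnt_lt l k h3 h4 h1 h2
  · simp only [invol_apply hσ]
    intro h3
    have := h.empty (σ q) h3.1 h3.2
    rw [invol_apply hσ] at this
    exact this ⟨h1, h2⟩

/-- Starting from a point of the graph of `σ` at whose upper corner the counts of `σ` and `τ`
differ, there is a closest further point such that they differ on the rectangle between them. -/
theorem exists_rise_above {n : ℕ} {σ τ : Perm (Fin n)} (hle : σ ≤ τ) {p : Fin n}
    (hp : cnt τ (p + 1) (σ p + 1) < cnt σ (p + 1) (σ p + 1)) :
    ∃ j, IsBox σ τ p j := by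
  classical
  rw [le_iff_cnt] at hle
  have hex : ∃ j, p < j ∧ σ p < σ j ∧
      ∀ k l, p.val < k → k ≤ j.val → (σ p).val < l → l ≤ (σ j).val → cnt τ k l < cnt σ k l := by
    -- The rectangle of difference is grown from the corner until `k + l` is maximal. It stays below
    -- `n`, since all counts agree at the border.
    let good : ℕ × ℕ → Prop := fun r => p.val < r.1 ∧ (σ p).val < r.2 ∧
      ∀ k l, p.val < k → k ≤ r.1 → (σ p).val < l → l ≤ r.2 → cnt τ k l < cnt σ k l
    obtain ⟨⟨k, l⟩, hkl, hmax⟩ := exists_max_image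
      ((range (n + 1) ×ˢ range (n + 1)).filter good) (fun r => r.1 + r.2)
      ⟨(p + 1, σ p + 1), by
        simp only [mem_filter, mem_product, mem_range]
        refine ⟨by omega, by simp, by simp, fun k l h1 h2 h3 h4 => ?_⟩
        simp only at h2 h4
        rwa [show k = p + 1 by omega, show l = σ p + 1 by omega]⟩
    simp only [mem_filter, mem_product, mem_range, good, Prod.forall] at hkl hmax
    obtain ⟨⟨hk, hl⟩, hpk, hpl, hgood⟩ := hkl
    have hkn : k < n := by
      by_contra hc
      have := hgood k l hpk le_rfl hpl le_rfl
      rw [← cnt_inv σ, ← cnt_inv τ, cnt_of_ge_right _ _ _ (by omega),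
        cnt_of_ge_right _ _ _ (by omega)] at this
      exact lt_irrefl _ this
    have hln : l < n := by
      by_contra hc
      have := hgood k l hpk le_rfl hpl le_rfl
      rw [cnt_of_ge_right _ _ _ (by omega), cnt_of_ge_right _ _ _ (by omega)] at this
      exact lt_irrefl _ this
    -- Maximality blocks growth in each direction, so the next column and the next row each contain
    -- a cut of equality.
    obtain ⟨l', hl1, hl2, hl3⟩ : ∃ l', (σ p).val < l' ∧ l' ≤ l ∧
        cnt σ (k + 1) l' ≤ cnt τ (k + 1) l' := by
      by_contra! hc
      have := hmax (k + 1) l ⟨⟨by omega, hl⟩, by omega, hpl, fun k' l' h1 h2 h3 h4 => ?_⟩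
      · omega
      · rcases Nat.lt_or_ge k k' with h | h
        · rw [show k' = k + 1 by omega]
          exact hc l' h3 h4
        · exact hgood k' l' h1 h h3 h4
    obtain ⟨k', hk1, hk2, hk3⟩ : ∃ k', p.val < k' ∧ k' ≤ k ∧
        cnt σ k' (l + 1) ≤ cnt τ k' (l + 1) := by
      by_contra! hc
      have := hmax k (l + 1) ⟨⟨hk, by omega⟩, hpk, by omega, fun k' l' h1 h2 h3 h4 => ?_⟩
      · omega
      · rcases Nat.lt_or_ge l l' with h | h
        · rw [show l' = l + 1 by omega]
          exact hc k' h1 h2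
        · exact hgood k' l' h1 h2 h3 h
    -- By inclusion–exclusion `σ` has more points than `τ` between these cuts, hence at least one.
    have r1 := cnt_rect σ (show k' ≤ k + 1 by omega) (show l' ≤ l + 1 by omega)
    have r2 := cnt_rect τ (show k' ≤ k + 1 by omega) (show l' ≤ l + 1 by omega)
    have g1 := hgood k' l' hk1 hk2 hl1 hl2
    have g2 := hle (k + 1) (l + 1)
    obtain ⟨q, hq⟩ := card_pos.1 (show 0 < (univ.filter fun p : Fin n =>
      (k' ≤ p.val ∧ p.val < k + 1) ∧ l' ≤ (σ p).val ∧ (σ p).val < l + 1).card by omega)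
    simp only [mem_filter, mem_univ, true_and] at hq
    refine ⟨q, Fin.lt_def.2 (by omega), Fin.lt_def.2 (by omega), fun k l h1 h2 h3 h4 => ?_⟩
    exact hgood k l h1 (by omega) h3 (by omega)
  -- A point inside the box of the leftmost such `j` would itself qualify, so that box is empty.
  obtain ⟨j, ⟨h1, h2, h3⟩, hmin⟩ := WellFounded.has_min (wellFounded_lt (α := Fin n))
    {j | p < j ∧ σ p < σ j ∧
      ∀ k l, p.val < k → k ≤ j.val → (σ p).val < l → l ≤ (σ j).val → cnt τ k l < cnt σ k l} hex
  refine ⟨j, h1, h2, h3, fun q hpq hqj hq => hmin q ⟨hpq, hq.1, fun k l a1 a2 a3 a4 => ?_⟩ hqj⟩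
  exact h3 k l a1 (by omega) a3 (by omega)

/-- The mirror image of `exists_rise_above`. -/
theorem exists_rise_below {n : ℕ} {σ τ : Perm (Fin n)} (hle : σ ≤ τ) {p : Fin n}
    (hp : cnt τ p (σ p) < cnt σ p (σ p)) :
    ∃ j, IsBox σ τ j p := by
  classical
  rw [le_iff_cnt] at hle
  have hex : ∃ j, j < p ∧ σ j < σ p ∧
      ∀ k l, j.val < k → k ≤ p.val → (σ j).val < l → l ≤ (σ p).val → cnt τ k l < cnt σ k l := by
    let good : ℕ × ℕ → Prop := fun r => r.1 ≤ p.val ∧ r.2 ≤ (σ p).val ∧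
      ∀ k l, r.1 ≤ k → k ≤ p.val → r.2 ≤ l → l ≤ (σ p).val → cnt τ k l < cnt σ k l
    obtain ⟨⟨k, l⟩, hkl, hmin⟩ := exists_min_image
      ((range (n + 1) ×ˢ range (n + 1)).filter good) (fun r => r.1 + r.2)
      ⟨(p, σ p), by
        simp only [mem_filter, mem_product, mem_range]
        refine ⟨by omega, le_rfl, le_rfl, fun k l h1 h2 h3 h4 => ?_⟩
        simp only at h1 h3
        rwa [show k = p by omega, show l = σ p by omega]⟩
    simp only [mem_filter, mem_product, mem_range, good, Prod.forall] at hkl hmin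
    obtain ⟨⟨hk, hl⟩, hpk, hpl, hgood⟩ := hkl
    have hk0 : 0 < k := by
      by_contra hc
      have := hgood k l le_rfl hpk le_rfl hpl
      rw [show k = 0 by omega, cnt_zero_left, cnt_zero_left] at this
      exact lt_irrefl _ this
    have hl0 : 0 < l := by
      by_contra hc
      have := hgood k l le_rfl hpk le_rfl hpl
      rw [← cnt_inv σ, ← cnt_inv τ, show l = 0 by omega, cnt_zero_left, cnt_zero_left] at this
      exact lt_irrefl _ this
    obtain ⟨l', hl1, hl2, hl3⟩ : ∃ l', l ≤ l' ∧ l' ≤ (σ p).val ∧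
        cnt σ (k - 1) l' ≤ cnt τ (k - 1) l' := by
      by_contra! hc
      have := hmin (k - 1) l ⟨⟨by omega, hl⟩, by omega, hpl, fun k' l' h1 h2 h3 h4 => ?_⟩
      · omega
      · rcases Nat.lt_or_ge k' k with h | h
        · rw [show k' = k - 1 by omega]
          exact hc l' h3 h4
        · exact hgood k' l' h h2 h3 h4
    obtain ⟨k', hk1, hk2, hk3⟩ : ∃ k', k ≤ k' ∧ k' ≤ p.val ∧
        cnt σ k' (l - 1) ≤ cnt τ k' (l - 1) := by
      by_contra! hc
      have := hmin k (l - 1) ⟨⟨hk, by omega⟩, hpk, by omega, fun k' l' h1 h2 h3 h4 => ?_⟩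
      · omega
      · rcases Nat.lt_or_ge l' l with h | h
        · rw [show l' = l - 1 by omega]
          exact hc k' h1 h2
        · exact hgood k' l' h1 h2 h h4
    have r1 := cnt_rect σ (show k - 1 ≤ k' by omega) (show l - 1 ≤ l' by omega)
    have r2 := cnt_rect τ (show k - 1 ≤ k' by omega) (show l - 1 ≤ l' by omega)
    have g1 := hgood k' l' hk1 hk2 hl1 hl2
    have g2 := hle (k - 1) (l - 1)
    obtain ⟨q, hq⟩ := card_pos.1 (show 0 < (univ.filter fun p : Fin n =>
      (k - 1 ≤ p.val ∧ p.val < k') ∧ l - 1 ≤ (σ p).val ∧ (σ p).val < l').card by omega)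
    simp only [mem_filter, mem_univ, true_and] at hq
    refine ⟨q, Fin.lt_def.2 (by omega), Fin.lt_def.2 (by omega), fun k l h1 h2 h3 h4 => ?_⟩
    exact hgood k l (by omega) h2 (by omega) h4
  obtain ⟨j, ⟨h1, h2, h3⟩, hmax⟩ := WellFounded.has_min (wellFounded_gt (α := Fin n))
    {j | j < p ∧ σ j < σ p ∧
      ∀ k l, j.val < k → k ≤ p.val → (σ j).val < l → l ≤ (σ p).val → cnt τ k l < cnt σ k l} hex
  refine ⟨j, h1, h2, h3, fun q hpq hqj hq => hmax q ⟨hqj, hq.2, fun k l a1 a2 a3 a4 => ?_⟩ hpq⟩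
  exact h3 k l (by omega) a2 (by omega) a4

/-- Two distinct comparable permutations differ at the upper corner of a graph point. -/
theorem exists_corner {n : ℕ} {σ τ : Perm (Fin n)} (hlt : σ < τ) :
    ∃ p : Fin n, cnt τ (p + 1) (σ p + 1) < cnt σ (p + 1) (σ p + 1) := by
  classical
  have hle := le_iff_cnt.1 hlt.le
  have hex : ∃ s, ∃ k l, k + l = s ∧ cnt τ k l < cnt σ k l := by
    by_contra! hc
    exact hlt.ne (eq_of_cnt_eq fun k l => le_antisymm (hc _ k l rfl) (hle k l))
  obtain ⟨k, l, hs, hkl⟩ := Nat.find_spec hex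
  have hmin : ∀ k' l', k' + l' < k + l → cnt σ k' l' ≤ cnt τ k' l' := by
    intro k' l' h
    by_contra! hc
    exact Nat.find_min hex (hs ▸ h) ⟨k', l', rfl, hc⟩
  have hk0 : 0 < k := by
    by_contra hc
    rw [show k = 0 by omega, cnt_zero_left, cnt_zero_left] at hkl
    exact lt_irrefl _ hkl
  have hl0 : 0 < l := by
    by_contra hc
    rw [← cnt_inv σ, ← cnt_inv τ, show l = 0 by omega, cnt_zero_left, cnt_zero_left] at hkl
    exact lt_irrefl _ hkl
  -- At a first cut of difference the other three corners of the unit cell show equality, so the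
  -- cell contains a point of `σ`.
  have r1 := cnt_rect σ (show k - 1 ≤ k by omega) (show l - 1 ≤ l by omega)
  have r2 := cnt_rect τ (show k - 1 ≤ k by omega) (show l - 1 ≤ l by omega)
  have m1 := hmin (k - 1) l (by omega)
  have m2 := hmin k (l - 1) (by omega)
  have m3 := hle (k - 1) (l - 1)
  obtain ⟨q, hq⟩ := card_pos.1 (show 0 < (univ.filter fun p : Fin n =>
    (k - 1 ≤ p.val ∧ p.val < k) ∧ l - 1 ≤ (σ p).val ∧ (σ p).val < l).card by omega)
  simp only [mem_filter, mem_univ, true_and] at hq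
  refine ⟨q, ?_⟩
  rwa [show q.val + 1 = k by omega, show (σ q).val + 1 = l by omega]

/-! ### Climbing by two inversions with at most one fixed point. -/

theorem even_card_of_fixedPointFree_invol {n : ℕ} {σ : Perm (Fin n)} (hσ : σ * σ = 1)
    (s : Finset (Fin n)) (hs : ∀ p ∈ s, σ p ∈ s) (hf : ∀ p ∈ s, σ p ≠ p) : Even s.card := by
  rw [← ZMod.natCast_eq_zero_iff_even]
  have : ∑ p ∈ s, (1 : ZMod 2) = 0 :=
    sum_involution (fun p _ => σ p) (fun _ _ => by decide) (fun p hp _ => hf p hp) hs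
      (fun p _ => invol_apply hσ p)
  simpa using this

/-- On a diagonal square the points that are not fixed come in pairs `p`, `σ p`. -/
theorem cnt_self_mod_two {n : ℕ} {σ : Perm (Fin n)} (hσ : σ * σ = 1) (k : ℕ) :
    cnt σ k k % 2 = (univ.filter fun p : Fin n => p.val < k ∧ σ p = p).card % 2 := by
  have h1 : cnt σ k k = (univ.filter fun p : Fin n => p.val < k ∧ σ p = p).card +
      (univ.filter fun p : Fin n => (p.val < k ∧ (σ p).val < k) ∧ σ p ≠ p).card := by
    rw [cnt, ← card_union_of_disjoint]
    · congr 1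
      ext p
      simp only [mem_union, mem_filter, mem_univ, true_and]
      by_cases h : σ p = p <;> simp [h]
    · rw [disjoint_left]
      intro p
      simp only [mem_filter, mem_univ, true_and]
      tauto
  have h2 := even_card_of_fixedPointFree_invol hσ
    (univ.filter fun p : Fin n => (p.val < k ∧ (σ p).val < k) ∧ σ p ≠ p) (fun p hp => by
      simp only [mem_filter, mem_univ, true_and, invol_apply hσ] at hp ⊢
      exact ⟨⟨hp.1.2, hp.1.1⟩, hp.2.symm⟩) (fun p hp => by
      simp only [mem_filter] at hp
      exact hp.2.2)
  rw [Nat.even_iff] at h2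
  omega

/-- The far corner `j` of the box cannot be fixed by uniqueness, and reflection in the diagonal
makes `j < σ j`, as a rise from a fixed point requires. -/
theorem exists_conjSwap_le_of_fixed_corner_above {n : ℕ} {σ τ : Perm (Fin n)} (hσ : σ * σ = 1)
    (hτ : τ * τ = 1) (huniq : ∀ p q, σ p = p → σ q = q → p = q) (hle : σ ≤ τ)
    {f : Fin n} (hf : σ f = f)
    (hc : cnt τ (f + 1) (f + 1) < cnt σ (f + 1) (f + 1)) :
    ∃ x y, IsRise σ x y ∧ conjSwap σ x y ≤ τ := by
  obtain ⟨j, hj, hlt⟩ : ∃ j, IsBox σ τ f j ∧ j < σ j := by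
    obtain ⟨j, hj⟩ := exists_rise_above hle (p := f) (by rwa [hf])
    rcases lt_trichotomy j (σ j) with h | h | h
    · exact ⟨j, hj, h⟩
    · exact absurd (huniq f j hf h.symm) hj.lt.ne
    · have := hj.symm hσ hτ
      rw [hf] at this
      exact ⟨σ j, this, by rwa [invol_apply hσ]⟩
  have hr : IsRise σ f j := ⟨hσ, hj.lt, hj.map_lt, hf.le, fun _ => hlt, Or.inr hlt.le, hj.empty⟩
  exact ⟨f, j, hr, hr.conjSwap_le hτ hle hj.cnt_lt fun _ h => absurd hf h.ne⟩

theorem exists_conjSwap_le_of_fixed_corner_below {n : ℕ} {σ τ : Perm (Fin n)} (hσ : σ * σ = 1)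
    (hτ : τ * τ = 1) (huniq : ∀ p q, σ p = p → σ q = q → p = q) (hle : σ ≤ τ)
    {f : Fin n} (hf : σ f = f)
    (hc : cnt τ f f < cnt σ f f) : ∃ x y, IsRise σ x y ∧ conjSwap σ x y ≤ τ := by
  obtain ⟨j, hj, hlt⟩ : ∃ j, IsBox σ τ j f ∧ σ j < j := by
    obtain ⟨j, hj⟩ := exists_rise_below hle (p := f) (by rwa [hf])
    rcases lt_trichotomy j (σ j) with h | h | h
    · have := hj.symm hσ hτ
      rw [hf] at this
      exact ⟨σ j, this, by rwa [invol_apply hσ]⟩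
    · exact absurd (huniq j f h.symm hf) hj.lt.ne
    · exact ⟨j, hj, h⟩
  have hr : IsRise σ j f :=
    ⟨hσ, hj.lt, hj.map_lt, hlt.le, fun h => absurd h hlt.ne, Or.inr hf.ge, hj.empty⟩
  exact ⟨j, f, hr, hr.conjSwap_le hτ hle hj.cnt_lt fun h _ => absurd hf h.ne'⟩

/-- This is the case that needs a difference of 2 on a square. On the diagonal it follows from equal
parity. -/
theorem exists_conjSwap_le_of_nested {n : ℕ} {σ τ : Perm (Fin n)} (hσ : σ * σ = 1)
    (hτ : τ * τ = 1) (hle : σ ≤ τ)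
    (hpar : ∀ k, cnt σ k k % 2 = cnt τ k k % 2) {p y : Fin n} (hb : IsBox σ τ p y)
    (hp : σ p < p) (hy : y < σ y) : ∃ x y, IsRise σ x y ∧ conjSwap σ x y ≤ τ := by
  have hr : IsRise σ p y :=
    ⟨hσ, hb.lt, hb.map_lt, hp.le, fun h => absurd h hp.ne, Or.inr hy.le, hb.empty⟩
  refine ⟨p, y, hr, hr.conjSwap_le hτ hle hb.cnt_lt fun _ _ => ?_⟩
  have hdiag : ∀ k, p.val < k → k ≤ y.val → cnt τ k k + 2 ≤ cnt σ k k := by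
    intro k h1 h2
    have := hb.cnt_lt k k h1 h2 (by omega) (by omega)
    have := hpar k
    omega
  -- The square from `k` to `l` has no point of `σ`, so by symmetry `cnt σ k l` is the mean of the
  -- two diagonal counts, while `cnt τ k l` is at most the corresponding mean.
  have hlt : ∀ k l, p.val < k → k < l → l ≤ y.val → cnt τ k l + 2 ≤ cnt σ k l := by
    intro k l h1 h2 h3
    have d1 := hdiag k h1 (by omega)
    have d2 := hdiag l (by omega) h3
    have r1 := cnt_rect σ h2.le h2.le
    have r2 := cnt_rect τ h2.le h2.le
    rw [cnt_comm hσ l k, card_eq_zero.2] at r1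
    · rw [cnt_comm hτ l k] at r2
      omega
    · refine filter_eq_empty_iff.2 fun q _ hq => ?_
      refine hb.empty q (Fin.lt_def.2 (by omega)) (Fin.lt_def.2 (by omega)) ⟨?_, ?_⟩ <;>
      · rw [Fin.lt_def] at *
        omega
  intro k l h1 h2 h3 h4
  rcases lt_trichotomy k l with h | h | h
  · exact hlt k l h1 h h4
  · rw [← h]
    exact hdiag k h1 h2
  · rw [cnt_comm hσ, cnt_comm hτ]
    exact hlt l k h3 h h2

theorem exists_conjSwap_le_of_even {n : ℕ} {σ τ : Perm (Fin n)} (hσ : σ * σ = 1)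
    (hτ : τ * τ = 1) (huniq : ∀ p q, σ p = p → σ q = q → p = q) (hle : σ ≤ τ)
    (hne : σ ≠ τ)
    (hpar : ∀ k, cnt σ k k % 2 = cnt τ k k % 2) :
    ∃ x y, IsRise σ x y ∧ conjSwap σ x y ≤ τ := by
  obtain ⟨p, hc, hp⟩ : ∃ p : Fin n, cnt τ (p + 1) (σ p + 1) < cnt σ (p + 1) (σ p + 1) ∧
      σ p ≤ p := by
    obtain ⟨p, hp⟩ := exists_corner (lt_of_le_of_ne hle hne)
    rcases le_total (σ p) p with h | h
    · exact ⟨p, hp, h⟩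
    · refine ⟨σ p, ?_, by rwa [invol_apply hσ]⟩
      rw [invol_apply hσ, cnt_comm hσ, cnt_comm hτ]
      exact hp
  rcases hp.eq_or_lt with hf | hp
  · rw [hf] at hc
    exact exists_conjSwap_le_of_fixed_corner_above hσ hτ huniq hle hf hc
  obtain ⟨j, hj⟩ := exists_rise_above hle hc
  have hjp : σ j ≠ p := by
    intro h
    have h1 := hj.lt
    rw [← h, invol_apply hσ] at hp
    rw [← h] at h1
    exact lt_asymm hp h1
  rcases lt_or_gt_of_ne hjp with h | h
  · have hr : IsRise σ p j :=
      ⟨hσ, hj.lt, hj.map_lt, hp.le, fun h => absurd h hp.ne, Or.inl h, hj.empty⟩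
    exact ⟨p, j, hr, hr.conjSwap_le hτ hle hj.cnt_lt fun h' _ => absurd (h.trans hj.lt) h'.not_gt⟩
  rcases lt_trichotomy j (σ j) with h' | h' | h'
  · exact exists_conjSwap_le_of_nested hσ hτ hle hpar hj hp h'
  · have hr : IsRise σ p j :=
      ⟨hσ, hj.lt, hj.map_lt, hp.le, fun h => absurd h hp.ne, Or.inr h'.le, hj.empty⟩
    exact ⟨p, j, hr, hr.conjSwap_le hτ hle hj.cnt_lt fun h _ => absurd h' h.ne⟩
  -- Here `p < σ j < j`, and `side` fails for the pair `p`, `j`. The pair `p`, `σ j` is nested, and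
  -- its box is covered by the old box and its reflection, split at height `p`.
  · have hs := hj.symm hσ hτ
    refine exists_conjSwap_le_of_nested hσ hτ hle hpar (p := p) (y := σ j) ?_ hp
      (by rwa [invol_apply hσ])
    refine ⟨h, by rw [invol_apply hσ]; exact hp.trans hj.lt, fun k l h1 h2 h3 h4 => ?_,
      fun q h1 h2 h3 => ?_⟩
    · rw [invol_apply hσ] at h4
      rcases Nat.lt_or_ge p.val l with hl | hl
      · exact hs.cnt_lt k l (by omega) h2 (by rwa [invol_apply hσ]) (by rwa [invol_apply hσ])
      · exact hj.cnt_lt k l h1 (by omega) h3 (by omega)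
    · rw [invol_apply hσ] at h3
      rcases lt_or_ge (σ q) (σ j) with hq | hq
      · exact hj.empty q h1 (h2.trans h') ⟨h3.1, hq⟩
      · refine hs.empty q (hp.trans h1) h2 ?_
        simp only [invol_apply hσ]
        exact ⟨h.trans_le hq, h3.2⟩

/-- In the classes of involutions with at most one fixed point one can climb by two inversions. -/
theorem exists_conjSwap_le {n a : ℕ} (ha : a ≤ 1) {σ τ : Perm (Fin n)} (hσ : σ ∈ F n a)
    (hτ : τ ∈ F n a) (hlt : σ < τ) : ∃ x y, IsRise σ x y ∧ conjSwap σ x y ≤ τ := by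
  obtain ⟨hσ, hσa⟩ := hσ
  obtain ⟨hτ, hτa⟩ := hτ
  have huniq : ∀ p q, σ p = p → σ q = q → p = q := by
    intro p q hp hq
    exact card_le_one.1 (hσa.trans_le ha) p (by simpa) q (by simpa)
  by_cases hpar : ∀ k, cnt σ k k % 2 = cnt τ k k % 2
  · exact exists_conjSwap_le_of_even hσ hτ huniq hlt.le hlt.ne hpar
  have hle := le_iff_cnt.1 hlt.le
  have ha1 : a = 1 := by
    by_contra h
    have ha0 : a = 0 := by omega
    refine hpar fun k => ?_
    rw [ha0, card_eq_zero, filter_eq_empty_iff] at hσa hτa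
    rw [cnt_self_mod_two hσ, cnt_self_mod_two hτ, filter_eq_empty_iff.2, filter_eq_empty_iff.2]
    · exact fun p _ h => hτa (mem_univ p) h.2
    · exact fun p _ h => hσa (mem_univ p) h.2
  rw [ha1, card_eq_one] at hσa hτa
  obtain ⟨f, hf⟩ := hσa
  obtain ⟨g, hg⟩ := hτa
  simp only [Finset.ext_iff, mem_filter, mem_univ, true_and, mem_singleton] at hf hg
  have hcard : ∀ (k : ℕ) (c : Fin n),
      (univ.filter fun p : Fin n => p.val < k ∧ p = c).card = if c.val < k then 1 else 0 := by
    intro k c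
    split_ifs with h
    · refine card_eq_one.2 ⟨c, ?_⟩
      ext p
      simp only [mem_filter, mem_univ, true_and, mem_singleton]
      exact ⟨fun h => h.2, fun h' => ⟨h' ▸ h, h'⟩⟩
    · refine card_eq_zero.2 (filter_eq_empty_iff.2 fun p _ hp => h (hp.2 ▸ hp.1))
  have p1 : ∀ k, cnt σ k k % 2 = (if f.val < k then 1 else 0) % 2 := by
    intro k
    rw [cnt_self_mod_two hσ, ← hcard k f]
    simp only [hf]
  have p2 : ∀ k, cnt τ k k % 2 = (if g.val < k then 1 else 0) % 2 := by
    intro k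
    rw [cnt_self_mod_two hτ, ← hcard k g]
    simp only [hg]
  -- Between the two fixed points the diagonal counts have different parities, which forces a strict
  -- difference at the cut just after or just before `f`.
  rcases lt_trichotomy f g with h | h | h
  · refine exists_conjSwap_le_of_fixed_corner_above hσ hτ huniq hlt.le ((hf f).2 rfl) ?_
    have q1 := p1 (f + 1)
    have q2 := p2 (f + 1)
    have := hle (f + 1) (f + 1)
    rw [if_pos (by omega)] at q1
    rw [if_neg (by omega)] at q2
    omega
  · exact absurd (fun k => by rw [p1, p2, h]) hpar
  · refine exists_conjSwap_le_of_fixed_corner_below hσ hτ huniq hlt.le ((hf f).2 rfl) ?_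
    have q1 := p1 f
    have q2 := p2 f
    have := hle f f
    rw [if_neg (by omega)] at q1
    rw [if_pos (by omega)] at q2
    omega

/-! ### Minimal elements of a class. -/

theorem inv_perm_le_inv_perm {n : ℕ} {σ τ : Perm (Fin n)} (h : σ ≤ τ) : σ⁻¹ ≤ τ⁻¹ := by
  rw [le_iff_cnt] at h ⊢
  intro k l
  rw [cnt_inv, cnt_inv]
  exact h l k

theorem mul_swap_le {n : ℕ} {σ : Perm (Fin n)} {x y : Fin n} (hxy : x < y) (h : σ y < σ x) :
    σ * swap x y ≤ σ := by
  rw [le_iff_cnt]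
  intro k l
  have := cnt_mul_swap (σ * swap x y) hxy (by simpa using h) k l
  rw [mul_assoc, swap_mul_self, mul_one] at this
  split_ifs at this <;> omega

/-- A descent of an involution that is not a transposed pair leads to a smaller conjugate. -/
theorem conjSwap_lt_of_descent {n : ℕ} {σ : Perm (Fin n)} (hσ : σ * σ = 1) {x y : Fin n}
    (hxy : x.val + 1 = y.val) (h : σ y < σ x) (hne : σ x ≠ y) : conjSwap σ x y < σ := by
  have hlt : x < y := Fin.lt_def.2 (by omega)
  have h1 := inv_perm_le_inv_perm (mul_swap_le hlt h)
  rw [inv_eq_of_mul_eq_one_left hσ, IsRise.inv_mul_swap_inv hσ] at h1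
  have h2 : (swap x y * σ) y < (swap x y * σ) x := by
    simp only [Perm.mul_apply, swap_apply_def]
    split_ifs <;> simp only [Fin.ext_iff, Fin.lt_def] at * <;> omega
  refine lt_of_le_of_ne ((mul_swap_le hlt h2).trans h1) fun he => ?_
  have h3 : swap x y (σ x) = σ y := by
    conv_rhs => rw [← he]
    simp [conjSwap]
  rw [swap_apply_def] at h3
  split_ifs at h3 with h4
  · rw [h4, ← h3] at h
    exact lt_asymm h hlt
  · exact h.ne h3.symm

/-- An involution all of whose descents are transposed pairs is a product of adjacent
transpositions. -/
theorem two_mul_inv_add_of_descents {n a : ℕ} {σ : Perm (Fin n)} (hσ : σ ∈ F n a)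
    (hd : ∀ x y : Fin n, x.val + 1 = y.val → σ y < σ x → σ x = y) : 2 * inv σ + a = n := by
  obtain ⟨hσ, ha⟩ := hσ
  have hub : ∀ p : Fin n, (σ p).val ≤ p.val + 1 := by
    -- Induction downwards from `n`: a value above `p + 1` at `p` would make a descent with the next
    -- index, and then `σ` would send `p` to `p + 1`.
    have hstep : ∀ (d p : ℕ) (hp : p < n), n - p = d → (σ ⟨p, hp⟩).val ≤ p + 1 := by
      intro d
      induction d with
      | zero => intro p hp h; omega
      | succ d ih =>
        intro p hp h
        by_contra! hc
        have hlt := (σ ⟨p, hp⟩).2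
        have h1 := ih (p + 1) (by omega) (by omega)
        have hne : (σ ⟨p, hp⟩).val ≠ (σ ⟨p + 1, by omega⟩).val := fun he => by
          simpa using σ.injective (Fin.ext he)
        have h2 := hd ⟨p, hp⟩ ⟨p + 1, by omega⟩ rfl (Fin.lt_def.2 (by omega))
        rw [h2] at hc
        simp at hc
    exact fun p => hstep _ p p.2 rfl
  have hlb : ∀ p : Fin n, p.val ≤ (σ p).val + 1 := by
    intro p
    have := hub (σ p)
    rwa [invol_apply hσ] at this
  have h1 : inv σ = (univ.filter fun p : Fin n => p < σ p).card := by
    unfold inv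
    refine card_bij' (fun r _ => r.1) (fun p _ => (p, σ p)) ?_ ?_ ?_ ?_
    · rintro ⟨p, q⟩ h
      simp only [mem_filter, mem_univ, true_and, Fin.lt_def] at h ⊢
      have := hlb q
      omega
    · intro p h
      simp only [mem_filter, mem_univ, true_and, invol_apply hσ] at h ⊢
      exact ⟨h, h⟩
    · rintro ⟨p, q⟩ h
      simp only [mem_filter, mem_univ, true_and, Fin.lt_def] at h
      have := hlb q
      have := hub p
      ext
      · rfl
      · simp only
        omega
    · intro p _
      rfl
  have h2 : (univ.filter fun p : Fin n => σ p < p).card =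
      (univ.filter fun p : Fin n => p < σ p).card := by
    refine card_bij' (fun p _ => σ p) (fun p _ => σ p) ?_ ?_ ?_ ?_ <;>
    simp [invol_apply hσ]
  have h3 : (univ.filter fun p : Fin n => p < σ p).card +
      (univ.filter fun p : Fin n => σ p < p).card +
      (univ.filter fun p : Fin n => σ p = p).card = n := by
    rw [← card_union_of_disjoint, ← card_union_of_disjoint]
    · conv_rhs => rw [← Fintype.card_fin n, ← card_univ]
      congr 1
      ext p
      simp only [mem_union, mem_filter, mem_univ, true_and, iff_true]
      rcases lt_trichotomy p (σ p) with h | h | h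
      · exact Or.inl (Or.inl h)
      · exact Or.inr h.symm
      · exact Or.inl (Or.inr h)
    · rw [disjoint_left]
      intro p
      simp only [mem_union, mem_filter, mem_univ, true_and]
      rintro (h | h) h'
      · exact h.ne h'.symm
      · exact h.ne h'
    · rw [disjoint_left]
      intro p
      simp only [mem_filter, mem_univ, true_and]
      exact fun h h' => lt_asymm h h'
  omega

theorem two_mul_inv_add_of_isMin {n a : ℕ} (σ : F n a) (hmin : IsMin σ) :
    2 * inv σ.1 + a = n := by
  refine two_mul_inv_add_of_descents σ.2 fun x y hxy h => ?_
  by_contra hne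
  have hlt := conjSwap_lt_of_descent σ.2.1 hxy h hne
  exact hmin.not_lt (b := ⟨_, conjSwap_mem_F σ.2 x y⟩) hlt

/-! ### From covering relations to gradedness. -/

/-- A finite poset with a greatest element and a rank function is graded. -/
theorem isGradedOfRank_of_isRankFunction {P : Type*} [PartialOrder P] [Finite P] {ρ : P → ℕ}
    (hρ : IsRankFunction ρ) {t : P} (ht : ∀ x, x ≤ t) : IsGradedOfRank P (ρ t) := by
  intro s hs
  have hmem : ∀ x, (∀ y ∈ s, x ≤ y ∨ y ≤ x) → x ∈ s := by
    intro x hx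
    by_contra hxs
    refine hxs ?_
    have := hs.2 (hs.1.insert fun y hy _ => hx y hy) (Set.subset_insert x s)
    rw [this]
    exact Set.mem_insert x s
  have hts : t ∈ s := hmem t fun y _ => Or.inr (ht y)
  have hcmp : ∀ x ∈ s, ∀ y ∈ s, x ≤ y ∨ y ≤ x := fun x hx y hy => hs.1.total hx hy
  -- The predecessor of `x` in a maximal chain is covered by `x` in the whole poset, so the elements
  -- of the chain below `x` number `ρ x`.
  have hcov : ∀ x ∈ s, ¬ IsMin x → ∃ y ∈ s, y ⋖ x := by
    intro x hx hmin
    obtain ⟨z, hz⟩ := not_isMin_iff.1 hmin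
    have hne : {y | y ∈ s ∧ y < x}.Nonempty := by
      by_contra hc
      rw [Set.not_nonempty_iff_eq_empty] at hc
      have hle : ∀ y ∈ s, x ≤ y := by
        intro y hy
        rcases hcmp x hx y hy with h | h
        · exact h
        · rcases h.eq_or_lt with h | h
          · exact h.ge
          · exact absurd (show y ∈ {y | y ∈ s ∧ y < x} from ⟨hy, h⟩) (by simp [hc])
      have hzs := hmem z fun y hy => Or.inl (hz.le.trans (hle y hy))
      exact absurd (show z ∈ {y | y ∈ s ∧ y < x} from ⟨hzs, hz⟩) (by simp [hc])
    obtain ⟨y, ⟨hy, hyx⟩, hmax⟩ := WellFounded.has_min (wellFounded_gt (α := P)) _ hne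
    refine ⟨y, hy, hyx, fun w h1 h2 => ?_⟩
    refine hmax w ⟨hmem w fun v hv => ?_, h2⟩ h1
    rcases hcmp x hx v hv with h | h
    · exact Or.inl (h2.le.trans h)
    rcases h.eq_or_lt with h | h
    · exact Or.inl (h ▸ h2.le)
    rcases hcmp v hv y hy with h' | h'
    · exact Or.inr (h'.trans h1.le)
    rcases h'.eq_or_lt with h' | h'
    · exact Or.inr (h' ▸ h1.le)
    · exact absurd h' (hmax v ⟨hv, h⟩)
  have hcount : ∀ x, x ∈ s → {y | y ∈ s ∧ y < x}.ncard = ρ x := by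
    intro x
    induction x using (wellFounded_lt (α := P)).induction with
    | _ x ih =>
      intro hx
      by_cases hmin : IsMin x
      · rw [hρ.eq_zero_of_isMin x hmin, Set.ncard_eq_zero]
        ext y
        simp only [Set.mem_ofPred_eq, Set.mem_empty_iff_false, iff_false]
        exact fun h => hmin.not_lt h.2
      · obtain ⟨y, hy, hyx⟩ := hcov x hx hmin
        rw [hρ.eq_succ_of_covBy y x hyx, ← ih y hyx.lt hy,
          ← Set.ncard_insert_of_notMem (a := y) (by simp)]
        congr 1
        ext z
        simp only [Set.mem_ofPred_eq, Set.mem_insert_iff]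
        constructor
        · rintro ⟨hz, hzx⟩
          rcases hcmp z hz y hy with h | h
          · exact h.eq_or_lt.imp id fun h => ⟨hz, h⟩
          · rcases h.eq_or_lt with h | h
            · exact Or.inl h.symm
            · exact absurd hzx (hyx.2 h)
        · rintro (rfl | ⟨hz, hzy⟩)
          · exact ⟨hy, hyx.lt⟩
          · exact ⟨hz, hzy.trans hyx.lt⟩
  rw [← hcount t hts, ← Set.ncard_insert_of_notMem (a := t) (by simp)]
  congr 1
  ext z
  simp only [Set.mem_insert_iff, Set.mem_ofPred_eq]
  constructor
  · exact fun hz => (ht z).eq_or_lt.imp id fun h => ⟨hz, h⟩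
  · rintro (rfl | h)
    exacts [hts, h.1]

/-- A statistic that is `c` at the minimal elements and increases by `2` along coverings yields
a rank function. -/
theorem exists_isRankFunction {P : Type*} [PartialOrder P] [Finite P] (f : P → ℕ) (c : ℕ)
    (hmin : ∀ x, IsMin x → f x = c) (hcov : ∀ x y, x ⋖ y → f y = f x + 2) :
    ∃ ρ : P → ℕ, IsRankFunction ρ ∧ ∀ x, (ρ x : ℚ) = ((f x : ℚ) - (c : ℚ)) / 2 := by
  have hex : ∀ x, ∃ r, f x = c + 2 * r := by
    intro x
    induction x using (wellFounded_lt (α := P)).induction with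
    | _ x ih =>
      by_cases h : IsMin x
      · exact ⟨0, hmin x h⟩
      · obtain ⟨y, hy⟩ := exists_covBy_of_wellFoundedGT h
        obtain ⟨r, hr⟩ := ih y hy.lt
        exact ⟨r + 1, by rw [hcov y x hy, hr]; ring⟩
  choose ρ hρ using hex
  refine ⟨ρ, ⟨fun x hx => ?_, fun x y hxy => ?_⟩, fun x => ?_⟩
  · have := hmin x hx
    have := hρ x
    omega
  · have := hcov x y hxy
    have := hρ x
    have := hρ y
    omega
  · rw [hρ x]
    push_cast
    ring

/-- The form in which gradedness of a class of involutions is established. -/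
theorem isGraded_and_exists_isRankFunction {n a : ℕ} (t : Perm (Fin n)) (ht : t ∈ F n a)
    (htop : ∀ σ ∈ F n a, σ ≤ t)
    (hrise : ∀ σ ∈ F n a, ∀ τ ∈ F n a, σ < τ → ∃ x y, IsRise σ x y ∧ conjSwap σ x y ≤ τ) :
    IsGraded (F n a) ∧ ∃ ρ : F n a → ℕ, IsRankFunction ρ ∧
      ∀ σ, (ρ σ : ℚ) = ((inv σ.1 : ℚ) - (((n - a) / 2 : ℕ) : ℚ)) / 2 := by
  -- The constant is the number of 2-cycles, hence of inversions of a minimal element.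
  obtain ⟨ρ, hρ, hinv⟩ := exists_isRankFunction (fun σ : F n a => inv σ.1) ((n - a) / 2)
    (fun σ hσ => by
      have := two_mul_inv_add_of_isMin σ hσ
      omega)
    (fun σ τ hστ => by
      obtain ⟨x, y, hr, hle⟩ := hrise σ.1 σ.2 τ.1 τ.2 hστ.lt
      have hle' : (⟨_, conjSwap_mem_F σ.2 x y⟩ : F n a) ≤ τ := hle
      rcases hle'.eq_or_lt with h | h
      · rw [← h]
        exact hr.inv_conjSwap
      · exact absurd h (hστ.2 (show σ < _ from hr.lt_conjSwap)))
  exact ⟨⟨_, isGradedOfRank_of_isRankFunction hρ (t := ⟨t, ht⟩) fun σ => htop σ.1 σ.2⟩,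
    ρ, hρ, hinv⟩

/-! ### The greatest element when at most one point is fixed. -/

theorem add_cnt_eq_add_card {n : ℕ} (σ : Perm (Fin n)) {k l : ℕ} (hk : k ≤ n) (hl : l ≤ n) :
    n + cnt σ k l = k + l + (univ.filter fun p : Fin n =>
      (k ≤ p.val ∧ p.val < n) ∧ l ≤ (σ p).val ∧ (σ p).val < n).card := by
  have := cnt_rect σ hk hl
  rw [cnt_of_ge_right σ n n le_rfl, cnt_of_ge_right σ k n le_rfl, ← cnt_inv σ l n,
    cnt_of_ge_right _ l n le_rfl] at this
  omega

/-- For cuts up to `n`, every count is at least `max 0 (k + l - n)`, and the reversal attains this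
bound. -/
theorem le_revPerm {n : ℕ} (σ : Perm (Fin n)) : σ ≤ Fin.revPerm := by
  rw [le_iff_cnt]
  intro k l
  rw [cnt_clamp, cnt_clamp σ]
  have hk : min k n ≤ n := min_le_right _ _
  have hl : min l n ≤ n := min_le_right _ _
  generalize min k n = k at *
  generalize min l n = l at *
  rcases Nat.lt_or_ge (k + l) n with h | h
  · rw [cnt, card_eq_zero.2]
    · exact Nat.zero_le _
    · refine filter_eq_empty_iff.2 fun p _ hp => ?_
      simp only [Fin.revPerm_apply, Fin.val_rev] at hp
      omega
  · have h1 := add_cnt_eq_add_card σ hk hl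
    have h2 := add_cnt_eq_add_card (Fin.revPerm (n := n)) hk hl
    rw [card_eq_zero.2] at h2
    · omega
    · refine filter_eq_empty_iff.2 fun p _ hp => ?_
      simp only [Fin.revPerm_apply, Fin.val_rev] at hp
      omega

theorem revPerm_mem_F {n a : ℕ} (ha : a ≤ 1) (hn : a % 2 = n % 2) : Fin.revPerm ∈ F n a := by
  refine ⟨by ext p; simp, ?_⟩
  rcases Nat.lt_or_ge a 1 with h | h
  · rw [show a = 0 by omega, card_eq_zero, filter_eq_empty_iff]
    intro p _ hp
    have := congrArg Fin.val hp
    simp only [Fin.revPerm_apply, Fin.val_rev] at this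
    omega
  · rw [show a = 1 by omega, card_eq_one]
    refine ⟨⟨n / 2, by omega⟩, ?_⟩
    ext p
    simp only [mem_filter, mem_univ, true_and, mem_singleton, Fin.ext_iff, Fin.revPerm_apply,
      Fin.val_rev]
    omega

theorem graded_of_le_one {n a : ℕ} (ha : a ≤ 1) (hn : a % 2 = n % 2) :
    IsGraded (F n a) ∧ ∃ ρ : F n a → ℕ, IsRankFunction ρ ∧
      ∀ σ, (ρ σ : ℚ) = ((inv σ.1 : ℚ) - ((n / 2 : ℕ) : ℚ)) / 2 := by
  have h := isGraded_and_exists_isRankFunction _ (revPerm_mem_F ha hn) (fun σ _ => le_revPerm σ)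
    fun σ hσ τ hτ hlt => exists_conjSwap_le ha hσ hτ hlt
  rwa [show (n - a) / 2 = n / 2 by omega] at h

/-! ### The class of transpositions. -/

theorem cnt_swap {n : ℕ} {x y : Fin n} (hxy : x < y) (k l : ℕ) :
    (cnt (swap x y) k l : ℤ) = cnt (1 : Perm (Fin n)) k l -
      if (x.val < k ∧ k ≤ y.val) ∧ x.val < l ∧ l ≤ y.val then 1 else 0 := by
  have := cnt_mul_swap (1 : Perm (Fin n)) hxy hxy k l
  rwa [one_mul] at this

theorem exists_swap_of_mem_F {n : ℕ} (hn : 2 ≤ n) {σ : Perm (Fin n)} (hσ : σ ∈ F n (n - 2)) :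
    ∃ x y, x < y ∧ σ = swap x y := by
  have h1 := card_filter_add_card_filter_not (s := (univ : Finset (Fin n)))
    (fun p => σ p = p)
  rw [hσ.2, card_univ, Fintype.card_fin] at h1
  have h2 : σ.support.card = 2 := by
    have : σ.support = univ.filter fun p => ¬ σ p = p := by
      ext p
      simp
    rw [this]
    omega
  obtain ⟨x, y, hxy, h⟩ := Perm.card_support_eq_two.1 h2
  rcases lt_or_gt_of_ne hxy with h' | h'
  · exact ⟨x, y, h', h⟩
  · exact ⟨y, x, h', by rw [h, swap_comm]⟩

theorem swap_mem_F {n : ℕ} {x y : Fin n} (hxy : x ≠ y) : swap x y ∈ F n (n - 2) := by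
  refine ⟨swap_mul_self x y, ?_⟩
  have h1 := card_filter_add_card_filter_not (s := (univ : Finset (Fin n)))
    (fun p => swap x y p = p)
  have h2 : (univ.filter fun p => ¬ swap x y p = p) = (swap x y).support := by
    ext p
    simp
  rw [h2, Perm.card_support_swap hxy, card_univ, Fintype.card_fin] at h1
  omega

/-- The smaller interval lies inside the larger. Moving one end outwards by a single step is a rise,
since nothing lies strictly between adjacent indices. -/
theorem exists_conjSwap_le_swap {n : ℕ} {i a i' a' : Fin n} (h : i < a) (h' : i' < a')
    (hlt : swap i a < swap i' a') :
    ∃ x y, IsRise (swap i a) x y ∧ conjSwap (swap i a) x y ≤ swap i' a' := by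
  have hle := le_iff_cnt.1 hlt.le
  have hi : i' ≤ i := by
    -- At this cut the smaller transposition already loses 1 against the identity, so the larger one
    -- must too.
    have h1 := hle (i + 1) (i + 1)
    zify at h1
    rw [cnt_swap h, cnt_swap h'] at h1
    by_contra hc
    split_ifs at h1 <;> omega
  have ha : a ≤ a' := by
    have h1 := hle a a
    zify at h1
    rw [cnt_swap h, cnt_swap h'] at h1
    by_contra hc
    split_ifs at h1 <;> omega
  rcases hi.lt_or_eq with hi | rfl
  · obtain ⟨x, hx⟩ : ∃ x : Fin n, x.val + 1 = i.val := ⟨⟨i - 1, by omega⟩, by simp only; omega⟩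
    have hxi : x < i := Fin.lt_def.2 (by omega)
    have e1 : swap i a x = x := swap_apply_of_ne_of_ne hxi.ne (hxi.trans h).ne
    have e2 : swap i a i = a := swap_apply_left _ _
    have hr : IsRise (swap i a) x i := ⟨swap_mul_self _ _, hxi, by rw [e1, e2]; exact hxi.trans h,
      e1.le, fun _ => by rwa [e2], Or.inr (by rw [e2]; exact h.le), fun p h1 h2 => by omega⟩
    refine ⟨x, i, hr, hr.conjSwap_le (swap_mul_self _ _) hlt.le (fun k l h1 h2 h3 h4 => ?_)
      fun _ h5 => absurd e1 h5.ne⟩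
    rw [e1] at h3
    rw [e2] at h4
    zify
    rw [cnt_swap h, cnt_swap h', if_pos (by omega), if_neg (by omega)]
    omega
  · have ha : a < a' := lt_of_le_of_ne ha fun he => hlt.ne (by rw [he])
    obtain ⟨y, hy⟩ : ∃ y : Fin n, y.val = a.val + 1 := ⟨⟨a + 1, by omega⟩, rfl⟩
    have hay : a < y := Fin.lt_def.2 (by omega)
    have e1 : swap i' a y = y := swap_apply_of_ne_of_ne (h.trans hay).ne' hay.ne'
    have e2 : swap i' a a = i' := swap_apply_right _ _
    have hr : IsRise (swap i' a) a y := ⟨swap_mul_self _ _, hay, by rw [e1, e2]; exact h.trans hay,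
      by rw [e2]; exact h.le, fun he => absurd he (by rw [e2]; exact h.ne), Or.inr e1.ge,
      fun p h1 h2 => by omega⟩
    refine ⟨a, y, hr, hr.conjSwap_le (swap_mul_self _ _) hlt.le (fun k l h1 h2 h3 h4 => ?_)
      fun h5 _ => absurd e1 h5.ne'⟩
    rw [e2] at h3
    rw [e1] at h4
    zify
    rw [cnt_swap h, cnt_swap h', if_pos (by omega), if_neg (by omega)]
    omega

theorem graded_transpositions {n : ℕ} (hn : 2 ≤ n) :
    IsGraded (F n (n - 2)) ∧ ∃ ρ : F n (n - 2) → ℕ, IsRankFunction ρ ∧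
      ∀ σ, (ρ σ : ℚ) = ((inv σ.1 : ℚ) - 1) / 2 := by
  have h0 : (⟨0, by omega⟩ : Fin n) < ⟨n - 1, by omega⟩ := Fin.lt_def.2 (by simp only; omega)
  have h := isGraded_and_exists_isRankFunction _ (swap_mem_F h0.ne) (fun σ hσ => ?_)
    fun σ hσ τ hτ hlt => ?_
  · rwa [show (n - (n - 2)) / 2 = 1 by omega, Nat.cast_one] at h
  · obtain ⟨x, y, hxy, rfl⟩ := exists_swap_of_mem_F hn hσ
    rw [le_iff_cnt]
    intro k l
    zify
    rw [cnt_swap hxy, cnt_swap h0]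
    simp only
    split_ifs <;> omega
  · obtain ⟨i, a, h1, rfl⟩ := exists_swap_of_mem_F hn hσ
    obtain ⟨i', a', h2, rfl⟩ := exists_swap_of_mem_F hn hτ
    exact exists_conjSwap_le_swap h1 h2 hlt

/-! ### The identity class, and involution classes as conjugacy classes. -/

theorem F_self (n : ℕ) : F n n = {1} := by
  ext σ
  constructor
  · rintro ⟨_, h⟩
    ext p
    have : (univ.filter fun p : Fin n => σ p = p) = univ :=
      eq_univ_of_card _ (by rw [h, Fintype.card_fin])
    have hp := mem_univ p
    rw [← this, mem_filter] at hp
    rw [hp.2, Perm.one_apply]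
  · rintro rfl
    exact ⟨mul_one 1, by simp⟩

theorem graded_one (n : ℕ) : IsGraded (F n n) := by
  rw [F_self]
  refine ⟨0, isGradedOfRank_of_isRankFunction (ρ := fun _ => 0) (t := ⟨1, rfl⟩)
    ⟨fun _ _ => rfl, fun x y h => ?_⟩ fun x => (Subsingleton.elim _ _).le⟩
  exact absurd (Subsingleton.elim x y) h.lt.ne

theorem card_support_add {n : ℕ} (σ : Perm (Fin n)) :
    σ.support.card + (univ.filter fun p : Fin n => σ p = p).card = n := by
  have h := card_filter_add_card_filter_not (s := (univ : Finset (Fin n))) (fun p => σ p = p)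
  have h2 : (univ.filter fun p => ¬ σ p = p) = σ.support := by
    ext p
    simp
  rw [h2, card_univ, Fintype.card_fin] at h
  omega

theorem cycleType_of_invol {n : ℕ} {σ : Perm (Fin n)} (hσ : σ * σ = 1) :
    ∃ k, σ.cycleType = Multiset.replicate k 2 ∧
      2 * k + (univ.filter fun p : Fin n => σ p = p).card = n := by
  refine ⟨_, Multiset.eq_replicate_card.2 (Perm.pow_prime_eq_one_iff.1 (by rwa [pow_two])), ?_⟩
  have h := Perm.sum_cycleType σ
  rw [Multiset.eq_replicate_card.2 (Perm.pow_prime_eq_one_iff.1 (by rwa [pow_two])),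
    Multiset.sum_replicate, smul_eq_mul] at h
  have := card_support_add σ
  omega

theorem nonempty_F {n a : ℕ} (ha : a ≤ n) (hn : a % 2 = n % 2) : (F n a).Nonempty := by
  obtain ⟨σ, hσ⟩ := (Perm.exists_with_cycleType_iff (Fin n)
    (m := Multiset.replicate ((n - a) / 2) 2)).2
    ⟨by rw [Multiset.sum_replicate, Fintype.card_fin, smul_eq_mul]; omega,
      fun k hk => (Multiset.eq_of_mem_replicate hk).ge⟩
  have h2 : σ ^ 2 = 1 := Perm.pow_prime_eq_one_iff.2 fun k hk => by
    rw [hσ] at hk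
    exact Multiset.eq_of_mem_replicate hk
  refine ⟨σ, by rwa [← pow_two], ?_⟩
  have h3 := Perm.sum_cycleType σ
  rw [hσ, Multiset.sum_replicate, smul_eq_mul] at h3
  have := card_support_add σ
  omega

theorem carrier_mk_eq_F {n a : ℕ} {σ : Perm (Fin n)} (hσ : σ ∈ F n a) :
    (ConjClasses.mk σ).carrier = F n a := by
  ext τ
  rw [ConjClasses.mem_carrier_iff_mk_eq, ConjClasses.mk_eq_mk_iff_isConj]
  constructor
  · intro h
    obtain ⟨π, rfl⟩ := isConj_iff.1 h.symm
    exact conj_mem_F hσ π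
  · intro hτ
    obtain ⟨k, hk, hk'⟩ := cycleType_of_invol hσ.1
    obtain ⟨k', hl, hl'⟩ := cycleType_of_invol hτ.1
    rw [hσ.2] at hk'
    rw [hτ.2] at hl'
    rw [Perm.isConj_iff_cycleType_eq, hk, hl, show k = k' by omega]

theorem mod_two_eq_of_mem_F {n a : ℕ} {σ : Perm (Fin n)} (hσ : σ ∈ F n a) :
    a ≤ n ∧ a % 2 = n % 2 := by
  obtain ⟨k, -, hk⟩ := cycleType_of_invol hσ.1
  rw [hσ.2] at hk
  omega

/-! ### Obstruction to gradedness, and block sums. -/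

/-- A poset with intervals of differing lengths is not graded. -/
theorem not_isGraded {P : Type*} [PartialOrder P] [Finite P] {x u y a b : P} (hxu : x ⋖ u)
    (huy : u ⋖ y) (hxa : x < a) (hab : a < b) (hby : b < y) : ¬ IsGraded P := by
  rintro ⟨r, hr⟩
  have hchain : IsChain (· ≤ ·) ({x, u, y} : Set P) := by
    have h1 := hxu.le
    have h2 := huy.le
    have h3 := h1.trans h2
    rintro v (rfl | rfl | rfl) w (rfl | rfl | rfl) hne <;> tauto
  obtain ⟨M, hM, hsub⟩ := hchain.exists_maxChain
  have hxM : x ∈ M := hsub (by simp)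
  have huM : u ∈ M := hsub (by simp)
  have hyM : y ∈ M := hsub (by simp)
  have hout : ∀ z ∈ M \ {u}, z ≤ x ∨ y ≤ z := by
    rintro z ⟨hz, hzu⟩
    rw [Set.mem_singleton_iff] at hzu
    rcases hM.1.total hz huM with h | h
    · have h := lt_of_le_of_ne h hzu
      rcases hM.1.total hz hxM with h' | h'
      · exact Or.inl h'
      · rcases h'.eq_or_lt with h' | h'
        · exact Or.inl h'.ge
        · exact absurd h (hxu.2 h')
    · have h := lt_of_le_of_ne h (Ne.symm hzu)
      rcases hM.1.total hz hyM with h' | h'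
      · rcases h'.eq_or_lt with h' | h'
        · exact Or.inr h'.ge
        · exact absurd h' (huy.2 h)
      · exact Or.inr h'
  have hxb := hxa.trans hab
  have hay := hab.trans hby
  have hbM : b ∉ M \ {u} := fun h => (hout b h).elim hxb.not_ge hby.not_ge
  have haM : a ∉ insert b (M \ {u}) := by
    rintro (h | h)
    · exact hab.ne h
    · exact (hout a h).elim hxa.not_ge hay.not_ge
  -- Apart from `u`, the chain `M` has nothing strictly between `x` and `y`, so replacing `u` by `a`
  -- and `b` gives a chain with one more element.
  have hnew : IsChain (· ≤ ·) (insert a (insert b (M \ {u}))) := by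
    refine ((hM.1.mono Set.sdiff_subset).insert fun z hz _ => ?_).insert fun z hz _ => ?_
    · exact (hout z hz).elim (fun h => Or.inr (h.trans hxb.le)) fun h => Or.inl (hby.le.trans h)
    · rcases hz with rfl | hz
      · exact Or.inl hab.le
      · exact (hout z hz).elim (fun h => Or.inr (h.trans hxa.le)) fun h => Or.inl (hay.le.trans h)
  obtain ⟨M', hM', hsub'⟩ := hnew.exists_maxChain
  have h1 := Set.ncard_le_ncard hsub' (Set.toFinite _)
  rw [Set.ncard_insert_of_notMem haM, Set.ncard_insert_of_notMem hbM, hr M' hM'] at h1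
  have h2 := Set.ncard_sdiff_singleton_add_one huM
  rw [hr M hM] at h2
  omega

/-- The block sum of two permutations. -/
def blockSum {r m : ℕ} (v : Perm (Fin r)) (z : Perm (Fin m)) : Perm (Fin (r + m)) :=
  finSumFinEquiv.permCongr (Perm.sumCongr v z)

@[simp] theorem blockSum_castAdd {r m : ℕ} (v : Perm (Fin r)) (z : Perm (Fin m)) (p : Fin r) :
    blockSum v z (Fin.castAdd m p) = Fin.castAdd m (v p) := by
  simp [blockSum, permCongr_apply]

@[simp] theorem blockSum_natAdd {r m : ℕ} (v : Perm (Fin r)) (z : Perm (Fin m)) (p : Fin m) :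
    blockSum v z (Fin.natAdd r p) = Fin.natAdd r (z p) := by
  simp [blockSum, permCongr_apply]

theorem cnt_blockSum {r m : ℕ} (v : Perm (Fin r)) (z : Perm (Fin m)) (k l : ℕ) :
    cnt (blockSum v z) k l = cnt v k l + cnt z (k - r) (l - r) := by
  zify
  rw [cnt_eq_sum, cnt_eq_sum, cnt_eq_sum, Fin.sum_univ_add]
  congr 1
  · simp
  · refine sum_congr rfl fun p _ => ?_
    simp only [blockSum_natAdd, Fin.val_natAdd]
    congr 1
    simp only [eq_iff_iff]
    omega

theorem blockSum_le_iff {r m : ℕ} {v w : Perm (Fin r)} {z : Perm (Fin m)} :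
    blockSum v z ≤ blockSum w z ↔ v ≤ w := by
  simp only [le_iff_cnt, cnt_blockSum, add_le_add_iff_right]

theorem blockSum_lt_iff {r m : ℕ} {v w : Perm (Fin r)} {z : Perm (Fin m)} :
    blockSum v z < blockSum w z ↔ v < w := by
  simp only [lt_iff_le_not_ge, blockSum_le_iff]

theorem blockSum_mem_F_iff {r m b c : ℕ} {v : Perm (Fin r)} {z : Perm (Fin m)}
    (hz : z ∈ F m c) :
    blockSum v z ∈ F (r + m) (b + c) ↔ v ∈ F r b := by
  have h1 : (univ.filter fun p => blockSum v z p = p).card =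
      (univ.filter fun p => v p = p).card + (univ.filter fun p => z p = p).card := by
    simp only [card_filter]
    rw [Fin.sum_univ_add]
    simp
  have h2 : blockSum v z * blockSum v z = 1 ↔ v * v = 1 := by
    constructor
    · intro h
      ext p
      have := invol_apply h (Fin.castAdd m p)
      rw [blockSum_castAdd, blockSum_castAdd] at this
      simpa using congrArg Fin.val this
    · intro h
      ext p
      refine congrArg Fin.val ?_
      refine Fin.addCases (fun p => ?_) (fun p => ?_) p
      · simp [invol_apply h]
      · simp [invol_apply hz.1]
  simp only [F, Set.mem_ofPred_eq, h1, h2, hz.2, add_left_inj]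

/-- A permutation between two block sums that differ only in the first block is a block sum. -/
theorem exists_eq_blockSum {r m : ℕ} {v w : Perm (Fin r)} {z : Perm (Fin m)}
    {σ : Perm (Fin (r + m))} (h1 : blockSum v z ≤ σ) (h2 : σ ≤ blockSum w z) : ∃ u, σ = blockSum u z := by
  rw [le_iff_cnt] at h1 h2
  -- Both bounds agree at these cuts. The cut at `(r, r)` shows that `σ` preserves the first block;
  -- the others then identify the second block as `z`.
  have hc : ∀ k l, cnt σ (r + k) (r + l) = r + cnt z k l := by
    intro k l
    have a1 := h1 (r + k) (r + l)
    have a2 := h2 (r + k) (r + l)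
    rw [cnt_blockSum, cnt_of_ge_right _ _ _ (Nat.le_add_right r l), Nat.add_sub_cancel_left,
      Nat.add_sub_cancel_left] at a1 a2
    omega
  have hmaps : ∀ p : Fin r, (σ (Fin.castAdd m p)).val < r := by
    have h := hc 0 0
    rw [cnt_zero_left, Nat.add_zero] at h
    have hs : (univ.filter fun p : Fin (r + m) => p.val < r ∧ (σ p).val < r) =
        univ.filter fun p : Fin (r + m) => p.val < r := by
      refine eq_of_subset_of_card_le (fun p hp => ?_) ?_
      · simp only [mem_filter] at hp ⊢
        exact ⟨hp.1, hp.2.1⟩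
      · rw [card_val_lt (by omega)]
        exact h.ge
    intro p
    have hp : Fin.castAdd m p ∈ univ.filter fun p : Fin (r + m) => p.val < r := by simp
    rw [← hs, mem_filter] at hp
    exact hp.2.2
  obtain ⟨⟨u, z'⟩, hu⟩ := Perm.mem_sumCongrHom_range_of_perm_mapsTo_inl
    (σ := finSumFinEquiv.symm.permCongr σ) (by
      rintro _ ⟨p, rfl⟩
      refine ⟨⟨_, hmaps p⟩, ?_⟩
      rw [permCongr_apply, symm_symm, finSumFinEquiv_apply_left, eq_symm_apply,
        finSumFinEquiv_apply_left]
      rfl)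
  have hσ : σ = blockSum u z' := by
    rw [blockSum, ← show Perm.sumCongrHom _ _ (u, z') = Perm.sumCongr u z' from rfl, hu]
    ext p
    simp [permCongr_apply]
  refine ⟨u, ?_⟩
  rw [hσ]
  congr 1
  refine eq_of_cnt_eq fun k l => ?_
  have := hc k l
  rw [hσ, cnt_blockSum, cnt_of_ge_right _ _ _ (Nat.le_add_right r l), Nat.add_sub_cancel_left,
    Nat.add_sub_cancel_left] at this
  omega

theorem blockSum_covBy {r m b c : ℕ} {v w : Perm (Fin r)} {z : Perm (Fin m)} (hv : v ∈ F r b)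
    (hw : w ∈ F r b) (hz : z ∈ F m c) (hlt : v < w)
    (h : ∀ u ∈ F r b, v ≤ u → u ≤ w → u = v ∨ u = w) :
    (⟨_, (blockSum_mem_F_iff hz).2 hv⟩ : F (r + m) (b + c)) ⋖
      ⟨_, (blockSum_mem_F_iff hz).2 hw⟩ := by
  refine ⟨blockSum_lt_iff.2 hlt, ?_⟩
  rintro ⟨σ, hσ⟩ h1 h2
  obtain ⟨u, rfl⟩ := exists_eq_blockSum (show _ ≤ σ from h1.le) (show σ ≤ _ from h2.le)
  have h1 : v < u := blockSum_lt_iff.1 h1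
  have h2 : u < w := blockSum_lt_iff.1 h2
  rcases h u ((blockSum_mem_F_iff hz).1 hσ) h1.le h2.le with rfl | rfl
  · exact h1.ne rfl
  · exact h2.ne rfl

/-! ### The counterexample in the symmetric group on six points. -/

theorem rankCount_six (v : Perm (Fin 6)) (k l : Fin 6) :
    rankCount v k l = (if 0 ≤ k ∧ l ≤ v 0 then 1 else 0) + (if 1 ≤ k ∧ l ≤ v 1 then 1 else 0) +
      (if 2 ≤ k ∧ l ≤ v 2 then 1 else 0) + (if 3 ≤ k ∧ l ≤ v 3 then 1 else 0) +
      (if 4 ≤ k ∧ l ≤ v 4 then 1 else 0) + (if 5 ≤ k ∧ l ≤ v 5 then 1 else 0) := by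
  rw [rankCount, card_filter, Fin.sum_univ_six]

theorem apply_eq_of_invol {n : ℕ} {v : Perm (Fin n)} (hv : v * v = 1) {i j : Fin n}
    (h : v i = j) : v j = i := by
  rw [← h, invol_apply hv]

theorem eq_of_values {v w : Perm (Fin 6)} (h0 : v 0 = w 0) (h1 : v 1 = w 1) (h2 : v 2 = w 2)
    (h3 : v 3 = w 3) (h4 : v 4 = w 4) (h5 : v 5 = w 5) : v = w := by
  refine Equiv.ext fun i => ?_
  fin_cases i <;> assumption

theorem lower_interval_F_six_two : ∀ v ∈ F 6 2, swap 0 1 * swap 3 5 ≤ v →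
    v ≤ swap 0 1 * swap 2 5 → v = swap 0 1 * swap 3 5 ∨ v = swap 0 1 * swap 2 5 := by
  rintro v ⟨hv, hf⟩ h1 h2
  have hv {i j : Fin 6} : v i = j → v j = i := apply_eq_of_invol hv
  -- These counts say that `v 0 ≥ 1`, that 5 is among the first four values, and that `v 0 < 2`.
  have r1 := h1 0 1
  have r2 := h1 3 5
  have r3 := h2 0 2
  rw [show rankCount (swap 0 1 * swap 3 5 : Perm (Fin 6)) 0 1 = 1 by decide] at r1
  rw [show rankCount (swap 0 1 * swap 3 5 : Perm (Fin 6)) 3 5 = 1 by decide] at r2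
  rw [show rankCount (swap 0 1 * swap 2 5 : Perm (Fin 6)) 0 2 = 0 by decide] at r3
  simp [rankCount_six] at r1 r2 r3
  rw [card_filter, Fin.sum_univ_six] at hf
  have e0 : v 0 = 1 := by split_ifs at r1 <;> omega
  have e1 := hv e0
  have hc : v 2 = 5 ∨ v 3 = 5 := by
    rw [e0, e1] at r2
    split_ifs at r2 <;> omega
  rcases hc with e2 | e3
  · have e5 := hv e2
    simp [e0, e1, e2, e5] at hf
    have e34 : v 3 = 3 ∧ v 4 = 4 := by split_ifs at hf <;> omega
    exact Or.inr (eq_of_values e0 e1 e2 e34.1 e34.2 e5)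
  · have e5 := hv e3
    simp [e0, e1, e3, e5] at hf
    have e24 : v 2 = 2 ∧ v 4 = 4 := by split_ifs at hf <;> omega
    exact Or.inl (eq_of_values e0 e1 e24.1 e3 e24.2 e5)

theorem upper_interval_F_six_two : ∀ v ∈ F 6 2, swap 0 1 * swap 2 5 ≤ v →
    v ≤ swap 0 5 * swap 3 4 → v = swap 0 1 * swap 2 5 ∨ v = swap 0 5 * swap 3 4 := by
  rintro v ⟨hv, hf⟩ h1 h2
  have hv {i j : Fin 6} : v i = j → v j = i := apply_eq_of_invol hv
  have r1 := h1 0 1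
  have r2 := h1 2 5
  have r3 := h2 1 2
  have r4 := h2 2 3
  rw [show rankCount (swap 0 1 * swap 2 5 : Perm (Fin 6)) 0 1 = 1 by decide] at r1
  rw [show rankCount (swap 0 1 * swap 2 5 : Perm (Fin 6)) 2 5 = 1 by decide] at r2
  rw [show rankCount (swap 0 5 * swap 3 4 : Perm (Fin 6)) 1 2 = 1 by decide] at r3
  rw [show rankCount (swap 0 5 * swap 3 4 : Perm (Fin 6)) 2 3 = 1 by decide] at r4
  simp [rankCount_six] at r1 r2 r3 r4
  rw [card_filter, Fin.sum_univ_six] at hf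
  -- The counts give `v 0 ≥ 1`, put 5 among the first three values, allow at most one of the first
  -- two values to reach 2, and at most one of the first three to reach 3.
  have hne {i j : Fin 6} (h : i ≠ j) : v i ≠ v j := v.injective.ne h
  have g0 : 1 ≤ v 0 := by split_ifs at r1 <;> omega
  have g01 : v 0 < 2 ∨ v 1 < 2 := by split_ifs at r3 <;> omega
  have hc : v 0 = 5 ∨ v 1 = 5 ∨ v 2 = 5 := by split_ifs at r2 <;> omega
  rcases hc with e0 | e1 | e2
  · have e5 := hv e0
    have g1 : v 1 < 2 := by omega
    have e1 : v 1 = 1 := by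
      have := hne (show (1 : Fin 6) ≠ 5 by decide)
      omega
    have g2 : v 2 < 3 := by
      rw [e0] at r4
      split_ifs at r4 <;> omega
    have e2 : v 2 = 2 := by
      have := hne (show (2 : Fin 6) ≠ 5 by decide)
      have := hne (show (2 : Fin 6) ≠ 1 by decide)
      omega
    simp [e0, e1, e2, e5] at hf
    have := hne (show (3 : Fin 6) ≠ 0 by decide)
    have := hne (show (3 : Fin 6) ≠ 1 by decide)
    have := hne (show (3 : Fin 6) ≠ 2 by decide)
    have := hne (show (3 : Fin 6) ≠ 5 by decide)
    have e3 : v 3 = 4 := by split_ifs at hf <;> omega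
    exact Or.inr (eq_of_values e0 e1 e2 e3 (hv e3) e5)
  · rw [e1] at g01
    have g0' : v 0 < 2 := g01.resolve_right (by decide)
    have e0 : v 0 = 1 := by omega
    rw [hv e0] at e1
    exact absurd e1 (by decide)
  · have e5 := hv e2
    have e0 : v 0 = 1 := by
      by_contra hc
      have g0 : v 0 = 2 := by
        rw [e2] at r4
        split_ifs at r4 <;> omega
      have := hv g0
      omega
    have e1 := hv e0
    simp [e0, e1, e2, e5] at hf
    have e34 : v 3 = 3 ∧ v 4 = 4 := by split_ifs at hf <;> omega
    exact Or.inl (eq_of_values e0 e1 e2 e34.1 e34.2 e5)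

/-- In `F 6 2` the chosen elements `x`, `u`, `y` have 4, 6 and 10 inversions: the second cover skips
a level, while the chain through `a` and `b` passes through 6 and 8. -/
theorem not_isGraded_F {n a : ℕ} (ha : 2 ≤ a) (han : a + 4 ≤ n) (hn : a % 2 = n % 2) :
    ¬ IsGraded (F n a) := by
  obtain ⟨m, rfl⟩ : ∃ m, n = 6 + m := ⟨n - 6, by omega⟩
  obtain ⟨c, rfl⟩ : ∃ c, a = 2 + c := ⟨a - 2, by omega⟩
  obtain ⟨z, hz⟩ := nonempty_F (n := m) (a := c) (by omega) (by omega)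
  have mx : (swap 0 1 * swap 3 5 : Perm (Fin 6)) ∈ F 6 2 := ⟨by decide, by decide⟩
  have mu : (swap 0 1 * swap 2 5 : Perm (Fin 6)) ∈ F 6 2 := ⟨by decide, by decide⟩
  have my : (swap 0 5 * swap 3 4 : Perm (Fin 6)) ∈ F 6 2 := ⟨by decide, by decide⟩
  have ma : (swap 0 2 * swap 3 5 : Perm (Fin 6)) ∈ F 6 2 := ⟨by decide, by decide⟩
  have mb : (swap 0 4 * swap 3 5 : Perm (Fin 6)) ∈ F 6 2 := ⟨by decide, by decide⟩
  have lt_of : ∀ v w : Perm (Fin 6), (∀ k l, rankCount v k l ≤ rankCount w k l) → v ≠ w → v < w :=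
    fun v w h hne => lt_of_le_of_ne h hne
  have lxu := lt_of (swap 0 1 * swap 3 5) (swap 0 1 * swap 2 5) (by decide) (by decide)
  have luy := lt_of (swap 0 1 * swap 2 5) (swap 0 5 * swap 3 4) (by decide) (by decide)
  have lxa := lt_of (swap 0 1 * swap 3 5) (swap 0 2 * swap 3 5) (by decide) (by decide)
  have lab := lt_of (swap 0 2 * swap 3 5) (swap 0 4 * swap 3 5) (by decide) (by decide)
  have lby := lt_of (swap 0 4 * swap 3 5) (swap 0 5 * swap 3 4) (by decide) (by decide)
  exact not_isGraded
    (blockSum_covBy mx mu hz lxu lower_interval_F_six_two)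
    (blockSum_covBy mu my hz luy upper_interval_F_six_two)
    (a := ⟨_, (blockSum_mem_F_iff hz).2 ma⟩) (b := ⟨_, (blockSum_mem_F_iff hz).2 mb⟩)
    (blockSum_lt_iff.2 lxa) (blockSum_lt_iff.2 lab) (blockSum_lt_iff.2 lby)

end BruhatInvolutions


theorem corollary2 (n : ℕ) :
    -- the sets `F_n^a`, for `a ≤ n` of the parity of `n`, are conjugacy classes
    (∀ a : ℕ, a ≤ n → a % 2 = n % 2 →
      ∃ C : ConjClasses (Equiv.Perm (Fin n)), C.carrier = BruhatInvolutions.F n a) ∧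
    -- the graded conjugacy classes of involutions
    (∀ C : ConjClasses (Equiv.Perm (Fin n)), (∀ σ ∈ C.carrier, σ * σ = 1) →
      (BruhatInvolutions.IsGraded C.carrier ↔
        C.carrier = BruhatInvolutions.F n 0 ∨
        C.carrier = BruhatInvolutions.F n 1 ∨
        (2 ≤ n ∧ C.carrier = BruhatInvolutions.F n (n - 2)) ∨
        C.carrier = BruhatInvolutions.F n n)) ∧
    -- `F_n^0`
    (Even n → BruhatInvolutions.IsGraded (BruhatInvolutions.F n 0) ∧
      ∃ ρ : BruhatInvolutions.F n 0 → ℕ, BruhatInvolutions.IsRankFunction ρ ∧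
        ∀ σ, (ρ σ : ℚ) = ((BruhatInvolutions.inv σ.1 : ℚ) - ((n / 2 : ℕ) : ℚ)) / 2) ∧
    -- `F_n^1`
    (Odd n → BruhatInvolutions.IsGraded (BruhatInvolutions.F n 1) ∧
      ∃ ρ : BruhatInvolutions.F n 1 → ℕ, BruhatInvolutions.IsRankFunction ρ ∧
        ∀ σ, (ρ σ : ℚ) = ((BruhatInvolutions.inv σ.1 : ℚ) - ((n / 2 : ℕ) : ℚ)) / 2) ∧
    -- `F_n^{n-2}`
    (2 ≤ n → BruhatInvolutions.IsGraded (BruhatInvolutions.F n (n - 2)) ∧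
      ∃ ρ : BruhatInvolutions.F n (n - 2) → ℕ, BruhatInvolutions.IsRankFunction ρ ∧
        ∀ σ, (ρ σ : ℚ) = ((BruhatInvolutions.inv σ.1 : ℚ) - 1) / 2) ∧
    -- `F_n^n`
    BruhatInvolutions.IsGraded (BruhatInvolutions.F n n) := by
  refine ⟨fun a ha hn => ?_, fun C hC => ?_, fun hn => ?_, fun hn => ?_, fun hn => ?_, ?_⟩
  · obtain ⟨σ, hσ⟩ := BruhatInvolutions.nonempty_F ha hn
    exact ⟨_, BruhatInvolutions.carrier_mk_eq_F hσ⟩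
  · obtain ⟨σ, rfl⟩ := ConjClasses.exists_rep C
    have hσ : σ ∈ BruhatInvolutions.F n (Finset.univ.filter fun i : Fin n => σ i = i).card :=
      ⟨hC σ ConjClasses.mem_carrier_mk, rfl⟩
    generalize (Finset.univ.filter fun i : Fin n => σ i = i).card = a at hσ
    obtain ⟨ha, hn⟩ := BruhatInvolutions.mod_two_eq_of_mem_F hσ
    rw [BruhatInvolutions.carrier_mk_eq_F hσ]
    constructor
    · intro hg
      by_contra hc
      have h0 : a ≠ 0 := fun h => hc (by simp [h])
      have h1 : a ≠ 1 := fun h => hc (by simp [h])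
      have h2 : ¬ (2 ≤ n ∧ a = n - 2) := fun h => hc (Or.inr (Or.inr (Or.inl ⟨h.1, by rw [h.2]⟩)))
      have h3 : a ≠ n := fun h => hc (by simp [h])
      -- Since `a` and `n` have equal parity, excluding `n` and `n - 2` leaves `a + 4 ≤ n`.
      exact BruhatInvolutions.not_isGraded_F (by omega) (by omega) hn hg
    · rintro (h | h | ⟨h2, h⟩ | h) <;> rw [h] at hσ ⊢
      · exact (BruhatInvolutions.graded_of_le_one (by omega)
          (BruhatInvolutions.mod_two_eq_of_mem_F hσ).2).1
      · exact (BruhatInvolutions.graded_of_le_one (by omega)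
          (BruhatInvolutions.mod_two_eq_of_mem_F hσ).2).1
      · exact (BruhatInvolutions.graded_transpositions h2).1
      · exact BruhatInvolutions.graded_one n
  · exact BruhatInvolutions.graded_of_le_one (by omega) (by rw [Nat.even_iff.1 hn])
  · exact BruhatInvolutions.graded_of_le_one (by omega) (by rw [Nat.odd_iff.1 hn])
  · exact BruhatInvolutions.graded_transpositions hn
  · exact BruhatInvolutions.graded_one n
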